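/- Let $\Gamma$ be a finite simple graph with at least one edge and without isolated vertices, let $n\in\mathbb N$ and $p\in[0,1]$. Let $E$ be the set of all $2$-element subsets of $\{1,\dots,n\}$ and let $(I_e)_{e\in E}$ be independent $\{0,1\}$-valued random variables with $P(I_e=1)=p$ (the edge indicators of the random graph $G(n,p)$). Let $J$ be the set of all $j\subset E$ such that the graph formed by the edges in $j$ and their end points is isomorphic to $\Gamma$. For $j\in J$ put $$Y_j=\prod_{e\in j}I_e,\qquad \sigma^2=\operatorname{Var}\Big(\sum_{j\in J}Y_j\Big),\qquad X_j=\sigma^{-1}(Y_j-E[Y_j]),\qquad W=\sum_{j\in J}X_j,$$ where $\sigma=\sqrt{\sigma^2}$ is assumed to be positive. For $j\in J$ let $N_j=\{k\in J : X_j \text{ and } X_k \text{ are dependent}\}$, let $D=\max_{j\in J}|N_j|$, and let $J_c$ be the set of all $(j_1,\dots,j_6)\in J^6$ with $j_m\in N_{j_1}\cup\dots\cup N_{j_{m-1}}$ for $m=2,\dots,6$. For $l\in\mathbb N$ and $z\in\mathbb R$ let $R_l(z)=\sum_{m=0}^\infty \frac{(iz)^m}{(m+l)!}$. For $j\in J$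 and $k\in N_j$ put $Z_j=\sum_{m\in N_j}X_m$ and $V_{jk}=\sum_{m\in N_k\setminus N_j}X_m$, and for $t\in\mathbb R$ let $$H_t=i\sum_{j\in J}X_jZ_j^2R_2(-tZ_j)-i\sum_{j\in J}\sum_{k\in N_j}\big(X_jX_k-E[X_jX_k]\big)(Z_j+V_{jk})R_1\big(-t(Z_j+V_{jk})\big).$$ For complex random variables write $\operatorname{Cov}(U,V)=E\big[(U-E[U])\,\overline{(V-E[V])}\big]$. Then for every $t\in\mathbb R$ $$\big|\operatorname{Cov}(H_t,e^{-itW})\big|\le\frac{20\,D^{5/2}}{\sigma^{5/2}}\Big(\sum_{j\in J}E|X_j|\Big)^{1/2}$$ and $$\big|\operatorname{Cov}(H_t,e^{-itW})\big|\le\frac{113}{\sigma^{3}}\Big(\sum_{(j_1,\dots,j_6)\in J_c}E\big[Y_{j_1}Y_{j_2}Y_{j_3}Y_{j_4}Y_{j_5}Y_{j_6}\big]\Big)^{1/2}.$$ -/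

import Mathlib

open MeasureTheory ProbabilityTheory
open scoped ComplexConjugate

noncomputable section

namespace SubgraphCount

/-! ### Complex covariance, the functions `R_l`, and the process `H_t` of a decomposition -/

/-- The (sesquilinear) covariance `Cov(U, V) = E[(U - E U) * conj (V - E V)]`
of complex random variables. -/
def complexCov {Ω : Type*} [MeasurableSpace Ω] (μ : Measure Ω) (U V : Ω → ℂ) : ℂ :=
  ∫ ω, (U ω - ∫ x, U x ∂μ) * conj (V ω - ∫ x, V x ∂μ) ∂μ

/-- `R_l(z) = ∑_{m ≥ 0} (i z)^m / (m + l)!` for real `z`. -/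
def R (l : ℕ) (z : ℝ) : ℂ :=
  ∑' m : ℕ, (Complex.I * (z : ℂ)) ^ m / ((m + l).factorial : ℂ)

/-- The process
`H_t = i ∑_j X_j Z_j^2 R_2(-t Z_j)
  - i ∑_j ∑_{k ∈ N_j} (X_j Z_{jk} - E[X_j Z_{jk}]) (Z_j + V_{jk}) R_1(-t (Z_j + V_{jk}))`
attached to a decomposition with index set `J`, neighbourhoods `N_j`, summands `X_j`, and
variables `Z_{jk}`, `V_{jk}`, where `Z_j = ∑_{k ∈ N_j} Z_{jk}`. -/
def decompositionProcess {Ω ι : Type*} [MeasurableSpace Ω] (μ : Measure Ω)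
    (J : Finset ι) (N : ι → Finset ι) (X : ι → Ω → ℝ) (Z V : ι → ι → Ω → ℝ)
    (t : ℝ) (ω : Ω) : ℂ :=
  let Zs : ι → ℝ := fun j => ∑ k ∈ N j, Z j k ω
  Complex.I * ∑ j ∈ J, ((X j ω * Zs j ^ 2 : ℝ) : ℂ) * R 2 (-t * Zs j)
    - Complex.I * ∑ j ∈ J, ∑ k ∈ N j,
        (((X j ω * Z j k ω - ∫ x, X j x * Z j k x ∂μ) * (Zs j + V j k ω) : ℝ) : ℂ)
          * R 1 (-t * (Zs j + V j k ω))

/-! ### The copies of a graph inside the complete graph on `n` vertices -/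

/-- The possible edges of a graph on the vertex set `Fin n`: the unordered pairs of distinct
vertices. -/
abbrev Edge (n : ℕ) : Type := {e : Sym2 (Fin n) // ¬ e.IsDiag}

/-- The graph on `Fin n` with a given set of edges. -/
def graphOf {n : ℕ} (j : Finset (Edge n)) : SimpleGraph (Fin n) :=
  SimpleGraph.fromEdgeSet {e | ∃ a ∈ j, (a : Sym2 (Fin n)) = e}

open Classical in
/-- The index set `J`: the sets `j` of edges such that the graph given by `j` (on the end points
of the edges in `j`, so that it has no isolated vertices) is isomorphic to `Γ`. -/
def copies {V : Type*} (Γ : SimpleGraph V) (n : ℕ) : Finset (Finset (Edge n)) :=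
  Finset.univ.filter fun j =>
    Nonempty ((graphOf j).induce (graphOf j).support ≃g Γ)

/-! ### The random variables of the subgraph count

`I e` is the indicator of the presence of the edge `e`. -/

variable {V Ω : Type*} [MeasurableSpace Ω] {n : ℕ}

/-- `Y_j = ∏_{e ∈ j} I_e`. -/
def Y (I : Edge n → Ω → ℝ) (j : Finset (Edge n)) (ω : Ω) : ℝ :=
  ∏ e ∈ j, I e ω

/-- `σ`, the standard deviation of the number of copies `∑_{j ∈ J} Y_j`. -/
def sigma (Γ : SimpleGraph V) (μ : Measure Ω) (I : Edge n → Ω → ℝ) : ℝ :=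
  Real.sqrt (variance (fun ω => ∑ j ∈ copies Γ n, Y I j ω) μ)

/-- `X_j = σ⁻¹ (Y_j - E[Y_j])`. -/
def X (Γ : SimpleGraph V) (μ : Measure Ω) (I : Edge n → Ω → ℝ) (j : Finset (Edge n)) (ω : Ω) : ℝ :=
  (sigma Γ μ I)⁻¹ * (Y I j ω - ∫ x, Y I j x ∂μ)

/-- `W = ∑_{j ∈ J} X_j`, the normalized number of copies. -/
def W (Γ : SimpleGraph V) (μ : Measure Ω) (I : Edge n → Ω → ℝ) (ω : Ω) : ℝ :=
  ∑ j ∈ copies Γ n, X Γ μ I j ω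

open Classical in
/-- `N_j = {k ∈ J | X_j and X_k are dependent}`. -/
def N (Γ : SimpleGraph V) (μ : Measure Ω) (I : Edge n → Ω → ℝ) (j : Finset (Edge n)) :
    Finset (Finset (Edge n)) :=
  (copies Γ n).filter fun k => ¬ IndepFun (X Γ μ I j) (X Γ μ I k) μ

/-- `D = max_{j ∈ J} |N_j|`. -/
def D (Γ : SimpleGraph V) (μ : Measure Ω) (I : Edge n → Ω → ℝ) : ℕ :=
  (copies Γ n).sup fun j => (N Γ μ I j).card

open Classical in
/-- `J_c`: the tuples `(j_1, …, j_6)` of copies in which each `j_m` with `m ≥ 2` lies in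
`N_{j_1} ∪ … ∪ N_{j_{m-1}}`. -/
def chains (Γ : SimpleGraph V) (μ : Measure Ω) (I : Edge n → Ω → ℝ) :
    Finset (Fin 6 → Finset (Edge n)) :=
  (Fintype.piFinset fun _ : Fin 6 => copies Γ n).filter fun j =>
    ∀ m : Fin 6, 0 < m → ∃ l : Fin 6, l < m ∧ j m ∈ N Γ μ I (j l)

open Classical in
/-- `V_{jk} = ∑_{l ∈ N_k \ N_j} X_l`. -/
def Vjk (Γ : SimpleGraph V) (μ : Measure Ω) (I : Edge n → Ω → ℝ) (j k : Finset (Edge n))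
    (ω : Ω) : ℝ :=
  ∑ l ∈ N Γ μ I k \ N Γ μ I j, X Γ μ I l ω

/-- The process `H_t` of the subgraph count: the one of the decomposition with `Z_{jk} = X_k` and
`V_{jk}` as above. -/
def H (Γ : SimpleGraph V) (μ : Measure Ω) (I : Edge n → Ω → ℝ) (t : ℝ) (ω : Ω) : ℂ :=
  decompositionProcess μ (copies Γ n) (N Γ μ I) (X Γ μ I) (fun _ k => X Γ μ I k)
    (Vjk Γ μ I) t ω

end SubgraphCount

end

/-! Since `e^{-itW}` has modulus one, the covariance is at most the standard deviation of `H_t`.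
Cancellation inside `e^{-itW}` plays no role; everything rests on bounding the variance of `H_t`, a
function of the edge indicators.

The tool is a comparison principle (`cubeVar_le`, `IsBernoulliFamily.variance_le`): if adding edges
changes `F` by at most the growth of a real function `P`, then `F` has variance at most that of `P`.
The increments of `H_t` are accessible because `y R_1(-ty)` has derivative `e^{-ity}` and `y²
R_2(-ty)` has derivative `y R_1(-ty)`, so both satisfy Lipschitz bounds that are uniform in `t`.

For the first estimate the summands `X_j` are bounded by `σ⁻¹`, and `P = 10 D² σ⁻³ ∑ Y_j` dominates.
Its standard deviation is `10 D² σ⁻²`. The missing factor comes from `1 = Var W ≤ D σ⁻¹ ∑ E|X_j|`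
(`one_le_D_mul_sum`).

For the second estimate `|X_j|` is bounded by `σ⁻¹ U_j` with `U_j = Y_j + E[Y_j]`, and `P` is `σ⁻³`
times a sum over triples `(j,k,l)` of products of such majorants (`norm_H_sub_le_triples`). The
covariance of two triples is at most `324` times the mean of the product of the six `Y`'s. It
vanishes when the triples share no edge; otherwise the six copies form a chain in one of four orders
(`sum_covariance_tripleTerm_le`). This gives the constant `√(4 · 324) = 36`. -/

namespace SubgraphCount

/-! ### Variance comparison on the discrete cube -/

section Cube

variable {E : Type*} [DecidableEq E] {M : Type*}

/-- The mean of a function of a random subset of `s` that contains each element independently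
with probability `p`. -/
noncomputable def cubeMean [AddCommGroup M] [Module ℝ M] (p : ℝ) (s : Finset E)
    (F : Finset E → M) : M :=
  ∑ T ∈ s.powerset, (p ^ T.card * (1 - p) ^ (s \ T).card) • F T

theorem cubeMean_empty [AddCommGroup M] [Module ℝ M] (p : ℝ) (F : Finset E → M) :
    cubeMean p ∅ F = F ∅ := by
  simp [cubeMean]

theorem cubeMean_insert [AddCommGroup M] [Module ℝ M] (p : ℝ) {s : Finset E} {a : E} (ha : a ∉ s)
    (F : Finset E → M) :
    cubeMean p (insert a s) F
      = (1 - p) • cubeMean p s F + p • cubeMean p s (fun T => F (insert a T)) := by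
  unfold cubeMean
  rw [Finset.sum_powerset_insert ha, Finset.smul_sum, Finset.smul_sum]
  congr 1
  · refine Finset.sum_congr rfl fun T hT => ?_
    have haT : a ∉ T := fun h => ha (Finset.mem_powerset.1 hT h)
    have haT' : a ∉ s \ T := fun h => ha (Finset.mem_sdiff.1 h).1
    rw [Finset.insert_sdiff_of_notMem _ haT, Finset.card_insert_of_notMem haT', smul_smul]
    congr 1
    ring
  · refine Finset.sum_congr rfl fun T hT => ?_
    have haT : a ∉ T := fun h => ha (Finset.mem_powerset.1 hT h)
    have h : insert a s \ insert a T = s \ T := by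
      rw [Finset.insert_sdiff_insert, Finset.sdiff_insert_of_notMem ha]
    rw [h, Finset.card_insert_of_notMem haT, smul_smul]
    congr 1
    ring

theorem cubeMean_sub [AddCommGroup M] [Module ℝ M] (p : ℝ) (s : Finset E) (F G : Finset E → M) :
    cubeMean p s (fun T => F T - G T) = cubeMean p s F - cubeMean p s G := by
  simp [cubeMean, smul_sub]

theorem norm_cubeMean_le [NormedAddCommGroup M] [NormedSpace ℝ M] {p : ℝ} (h0 : 0 ≤ p) (h1 : p ≤ 1)
    (s : Finset E) {F : Finset E → M} {P : Finset E → ℝ} (h : ∀ T, ‖F T‖ ≤ P T) :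
    ‖cubeMean p s F‖ ≤ cubeMean p s P := by
  refine (norm_sum_le _ _).trans (Finset.sum_le_sum fun T _ => ?_)
  have hw : 0 ≤ p ^ T.card * (1 - p) ^ (s \ T).card :=
    mul_nonneg (pow_nonneg h0 _) (pow_nonneg (sub_nonneg.2 h1) _)
  rw [norm_smul, Real.norm_of_nonneg hw, smul_eq_mul]
  exact mul_le_mul_of_nonneg_left (h T) hw

/-- The variance of a function of a random subset of `s`. -/
noncomputable def cubeVar [NormedAddCommGroup M] [NormedSpace ℝ M] (p : ℝ) (s : Finset E)
    (F : Finset E → M) : ℝ :=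
  cubeMean p s (fun T => ‖F T‖ ^ 2) - ‖cubeMean p s F‖ ^ 2

/-- Conditioning on whether `a` is present: the mean of the conditional variances plus the variance
of the two-valued conditional mean. -/
theorem cubeVar_insert [NormedAddCommGroup M] [InnerProductSpace ℝ M] (p : ℝ) {s : Finset E}
    {a : E} (ha : a ∉ s) (F : Finset E → M) :
    cubeVar p (insert a s) F
      = (1 - p) * cubeVar p s F + p * cubeVar p s (fun T => F (insert a T))
        + p * (1 - p) * ‖cubeMean p s (fun T => F (insert a T)) - cubeMean p s F‖ ^ 2 := by
  unfold cubeVar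
  rw [cubeMean_insert p ha, cubeMean_insert p ha, norm_add_sq_real, norm_sub_sq_real,
    inner_smul_left, inner_smul_right, norm_smul, norm_smul, mul_pow, mul_pow, Real.norm_eq_abs,
    Real.norm_eq_abs, sq_abs, sq_abs, real_inner_comm (cubeMean p s F)]
  simp only [smul_eq_mul, conj_trivial]
  ring

/-- A function on the cube whose increments are dominated by those of `P` has variance at most
that of `P`. -/
theorem cubeVar_le [NormedAddCommGroup M] [InnerProductSpace ℝ M] {p : ℝ} (h0 : 0 ≤ p)
    (h1 : p ≤ 1) (s : Finset E) {F : Finset E → M} {P : Finset E → ℝ}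
    (h : ∀ S T, S ⊆ T → ‖F T - F S‖ ≤ P T - P S) :
    cubeVar p s F ≤ cubeVar p s P := by
  induction s using Finset.induction_on generalizing F P with
  | empty => simp [cubeVar, cubeMean_empty]
  | insert a s ha ih =>
    rw [cubeVar_insert p ha, cubeVar_insert p ha]
    have hq : 0 ≤ 1 - p := sub_nonneg.2 h1
    have e0 := ih h
    have e1 := @ih (fun T => F (insert a T)) (fun T => P (insert a T))
      fun S T hST => h _ _ (Finset.insert_subset_insert a hST)
    -- The difference of the conditional means is the mean of the increments caused by adding `a`,
    -- so domination passes to it.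
    have e2 : ‖cubeMean p s (fun T => F (insert a T)) - cubeMean p s F‖
        ≤ ‖cubeMean p s (fun T => P (insert a T)) - cubeMean p s P‖ := by
      rw [← cubeMean_sub, ← cubeMean_sub]
      exact (norm_cubeMean_le h0 h1 s fun T => h _ _ (Finset.subset_insert a T)).trans
        (Real.le_norm_self _)
    gcongr

end Cube

/-- Independent `{0, 1}`-valued random variables with success probability `p`. -/
structure IsBernoulliFamily {E Ω : Type*} [MeasurableSpace Ω] (I : E → Ω → ℝ) (μ : Measure Ω)
    (p : ℝ) : Prop where
  meas : ∀ e, Measurable (I e)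
  ind : ∀ e ω, I e ω = 0 ∨ I e ω = 1
  law : ∀ e, μ.real {ω | I e ω = 1} = p
  indep : iIndepFun I μ

/-! ### Transfer from the cube to independent indicators -/

section Bernoulli

variable {E Ω : Type*} [MeasurableSpace Ω] {I : E → Ω → ℝ} {μ : Measure Ω}
  {p : ℝ}

theorem IsBernoulliFamily.real_iInter (hI : IsBernoulliFamily I μ p) (s : Finset E) (v : E → ℝ) :
    μ.real (⋂ e ∈ s, I e ⁻¹' {v e}) = ∏ e ∈ s, μ.real (I e ⁻¹' {v e}) := by
  have h := hI.indep.measure_inter_preimage_eq_mul s (sets := fun e => {v e})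
    fun e _ => measurableSet_singleton _
  simp only [Measure.real, h, ENNReal.toReal_prod]

theorem IsBernoulliFamily.real_one (hI : IsBernoulliFamily I μ p) (e : E) :
    μ.real (I e ⁻¹' {1}) = p := hI.law e

section Present

variable [Fintype E]

open Classical in
/-- The set of successes of a family of random variables. -/
noncomputable def present (I : E → Ω → ℝ) (ω : Ω) : Finset E := Finset.univ.filter fun e => I e ω = 1

theorem IsBernoulliFamily.present_subset (hI : IsBernoulliFamily I μ p) {ω ω' : Ω}
    (h : present I ω ⊆ present I ω') (e : E) : I e ω ≤ I e ω' := by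
  have := @h e
  rcases hI.ind e ω with h0 | h0 <;> rcases hI.ind e ω' with h1 | h1 <;>
    simp_all [present]

end Present

variable [IsProbabilityMeasure μ]

theorem IsBernoulliFamily.real_zero (hI : IsBernoulliFamily I μ p) (e : E) :
    μ.real (I e ⁻¹' {0}) = 1 - p := by
  have h : I e ⁻¹' {0} = (I e ⁻¹' {1})ᶜ := by
    ext ω
    rcases hI.ind e ω with h | h <;> simp [h]
  rw [h, probReal_compl_eq_one_sub (hI.meas e (measurableSet_singleton _)), hI.real_one]

variable [Fintype E] [DecidableEq E]

theorem IsBernoulliFamily.real_present (hI : IsBernoulliFamily I μ p) (T : Finset E) :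
    μ.real (present I ⁻¹' {T}) = p ^ T.card * (1 - p) ^ (Finset.univ \ T).card := by
  have h : present I ⁻¹' {T} = ⋂ e ∈ Finset.univ, I e ⁻¹' {if e ∈ T then (1 : ℝ) else 0} := by
    ext ω
    simp only [Set.mem_preimage, Set.mem_singleton_iff, Finset.mem_univ, Set.iInter_true,
      Set.mem_iInter, Finset.ext_iff, present, Finset.mem_filter, true_and]
    refine forall_congr' fun e => ?_
    rcases hI.ind e ω with h | h <;> by_cases he : e ∈ T <;> simp [h, he]
  rw [h, hI.real_iInter, ← Finset.prod_sdiff (Finset.subset_univ T), mul_comm]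
  congr 1
  · rw [Finset.prod_congr rfl (g := fun _ => p), Finset.prod_const]
    intro e he
    rw [if_pos he, hI.real_one]
  · rw [Finset.prod_congr rfl (g := fun _ => 1 - p), Finset.prod_const]
    intro e he
    rw [if_neg (Finset.mem_sdiff.1 he).2, hI.real_zero]

theorem IsBernoulliFamily.integral_present {M : Type*} [NormedAddCommGroup M] [NormedSpace ℝ M]
    [CompleteSpace M] (hI : IsBernoulliFamily I μ p) (φ : Finset E → M) :
    Integrable (fun ω => φ (present I ω)) μ ∧
      ∫ ω, φ (present I ω) ∂μ = cubeMean p Finset.univ φ := by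
  let _ : MeasurableSpace (Finset E) := ⊤
  have : DiscreteMeasurableSpace (Finset E) := ⟨fun _ => trivial⟩
  have hm : Measurable (present I) := by
    refine measurable_to_countable' fun T => ?_
    have h : present I ⁻¹' {T}
        = ⋂ e, {ω | I e ω = 1 ↔ e ∈ T} := by
      ext ω
      simp [present, Finset.ext_iff]
    rw [h]
    refine MeasurableSet.iInter fun e => ?_
    have h1 : MeasurableSet {ω | I e ω = 1} := hI.meas e (measurableSet_singleton 1)
    by_cases he : e ∈ T
    · simp only [he, iff_true]
      exact h1
    · simp only [he, iff_false]
      exact h1.compl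
  have : IsProbabilityMeasure (μ.map (present I)) := Measure.isProbabilityMeasure_map hm.aemeasurable
  have hφ : Integrable φ (μ.map (present I)) := Integrable.of_finite
  refine ⟨hφ.comp_measurable hm, ?_⟩
  rw [← integral_map hm.aemeasurable hφ.aestronglyMeasurable, integral_fintype hφ, cubeMean,
    Finset.powerset_univ]
  refine Finset.sum_congr rfl fun T _ => ?_
  rw [map_measureReal_apply hm (measurableSet_singleton T), hI.real_present]

/-- Every edge set has positive probability, so its fibre cannot be empty. A condition on sample
points thereby becomes a condition on all subsets. -/
theorem IsBernoulliFamily.present_surjective (hI : IsBernoulliFamily I μ p) (h0 : 0 < p)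
    (h1 : p < 1) : Function.Surjective (present I) := by
  intro T
  have h : 0 < μ.real (present I ⁻¹' {T}) := by
    rw [hI.real_present]
    have := sub_pos.2 h1
    positivity
  by_contra hT
  have : present I ⁻¹' {T} = ∅ := by
    ext ω
    simpa using fun hω => hT ⟨ω, hω⟩
  simp [this] at h

/-- A function of independent Bernoulli variables whose increments are dominated by those of `P`
has variance at most that of `P`. -/
theorem IsBernoulliFamily.variance_le (hI : IsBernoulliFamily I μ p) (h0 : 0 < p) (h1 : p < 1)
    {F : Ω → ℂ} {P : Ω → ℝ}
    (h : ∀ ω ω', (∀ e, I e ω ≤ I e ω') → ‖F ω' - F ω‖ ≤ P ω' - P ω) :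
    Integrable (fun ω => ‖F ω - ∫ x, F x ∂μ‖ ^ 2) μ ∧ Integrable F μ ∧
    ∫ ω, ‖F ω - ∫ x, F x ∂μ‖ ^ 2 ∂μ ≤ variance P μ := by
  obtain ⟨c, hc⟩ := (hI.present_surjective h0 h1).hasRightInverse
  have hle : ∀ ω ω', present I ω = present I ω' → ‖F ω' - F ω‖ ≤ P ω' - P ω :=
    fun ω ω' hω => h ω ω' (hI.present_subset hω.le)
  -- No measurability of `F` or `P` is assumed. Two sample points with the same successes are
  -- comparable in both directions, which forces equal values; hence both functions factor through
  -- the finite cube.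
  have hF : ∀ ω, F ω = F (c (present I ω)) := fun ω => by
    have e1 := hle ω _ (hc (present I ω)).symm
    have e2 := hle _ ω (hc (present I ω))
    have : ‖F (c (present I ω)) - F ω‖ ≤ 0 := by
      linarith [norm_sub_rev (F ω) (F (c (present I ω)))]
    exact (sub_eq_zero.1 (norm_le_zero_iff.1 this)).symm
  have hP : ∀ ω, P ω = P (c (present I ω)) := fun ω => by
    have e1 := (norm_nonneg _).trans (hle ω _ (hc (present I ω)).symm)
    have e2 := (norm_nonneg _).trans (hle _ ω (hc (present I ω)))
    linarith
  obtain ⟨φ, hφ⟩ : ∃ φ : Finset E → ℂ, F = fun ω => φ (present I ω) :=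
    ⟨fun T => F (c T), funext hF⟩
  obtain ⟨ψ, hψ⟩ : ∃ ψ : Finset E → ℝ, P = fun ω => ψ (present I ω) :=
    ⟨fun T => P (c T), funext hP⟩
  have key : cubeVar p Finset.univ φ ≤ cubeVar p Finset.univ ψ := by
    refine cubeVar_le h0.le h1.le _ fun S T hST => ?_
    have := h (c S) (c T) fun e => hI.present_subset (by rwa [hc, hc]) e
    simpa [hφ, hψ, hc _] using this
  have hvar : ∀ {M : Type} [NormedAddCommGroup M] [InnerProductSpace ℝ M] [CompleteSpace M]
      (φ : Finset E → M), ∫ ω, ‖φ (present I ω) - ∫ x, φ (present I x) ∂μ‖ ^ 2 ∂μ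
        = cubeVar p Finset.univ φ := by
    intro M _ _ _ φ
    set m := ∫ x, φ (present I x) ∂μ with hm
    have e : ∀ ω, ‖φ (present I ω) - m‖ ^ 2
        = ‖φ (present I ω)‖ ^ 2 - 2 * inner ℝ m (φ (present I ω)) + ‖m‖ ^ 2 := fun ω => by
      rw [norm_sub_sq_real, real_inner_comm]
    have i1 := (hI.integral_present fun T => ‖φ T‖ ^ 2)
    have i2 := (hI.integral_present φ)
    simp_rw [e]
    have i3 : Integrable (fun ω => 2 * inner ℝ m (φ (present I ω))) μ :=
      (i2.1.const_inner m).const_mul 2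
    have i4 : Integrable (fun ω => ‖φ (present I ω)‖ ^ 2 - 2 * inner ℝ m (φ (present I ω))) μ :=
      i1.1.sub i3
    rw [integral_add i4 (integrable_const _), integral_sub i1.1 i3, integral_const_mul,
      integral_inner i2.1, ← hm, real_inner_self_eq_norm_sq, i1.2, cubeVar, ← i2.2, ← hm]
    simp
    ring
  have hPi := hI.integral_present (fun T => ψ T)
  refine ⟨?_, ?_, ?_⟩
  · subst hφ
    exact (hI.integral_present fun T => ‖φ T - ∫ x, φ (present I x) ∂μ‖ ^ 2).1
  · subst hφ
    exact (hI.integral_present φ).1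
  · have hm : AEMeasurable P μ := by
      subst hψ
      exact hPi.1.aemeasurable
    rw [variance_eq_integral hm]
    subst hφ hψ
    rw [hvar φ]
    refine key.trans_eq ?_
    rw [← hvar ψ]
    simp

end Bernoulli

/-! ### Lipschitz bounds for the Taylor remainders -/

section Remainder

theorem I_mul_R_one (z : ℝ) : Complex.I * z * R 1 z = Complex.exp (Complex.I * z) - 1 := by
  have h : HasSum (fun m : ℕ => (Complex.I * (z : ℂ)) ^ m / (m.factorial : ℂ))
      (Complex.exp (Complex.I * z)) := by
    rw [Complex.exp_eq_exp_ℂ]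
    exact NormedSpace.expSeries_div_hasSum_exp _
  have h1 := (hasSum_nat_add_iff' 1).2 h
  rw [R, ← tsum_mul_left]
  simp only [Finset.range_one, Finset.sum_singleton, pow_zero, Nat.factorial_zero, Nat.cast_one,
    div_one] at h1
  rw [← h1.tsum_eq]
  refine tsum_congr fun m => ?_
  rw [pow_succ]
  ring

theorem I_mul_sq_mul_R_two (z : ℝ) :
    (Complex.I * z) ^ 2 * R 2 z = Complex.exp (Complex.I * z) - 1 - Complex.I * z := by
  have h : HasSum (fun m : ℕ => (Complex.I * (z : ℂ)) ^ m / (m.factorial : ℂ))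
      (Complex.exp (Complex.I * z)) := by
    rw [Complex.exp_eq_exp_ℂ]
    exact NormedSpace.expSeries_div_hasSum_exp _
  have h1 := (hasSum_nat_add_iff' 2).2 h
  rw [R, ← tsum_mul_left]
  simp only [Finset.sum_range_succ, Finset.range_zero, Finset.sum_empty, zero_add, pow_zero,
    Nat.factorial_zero, Nat.cast_one, div_one, pow_one, Nat.factorial_one, ← sub_sub] at h1
  rw [← h1.tsum_eq]
  refine tsum_congr fun m => ?_
  rw [pow_add]
  ring

theorem R_zero (l : ℕ) : R l 0 = 1 / (l.factorial : ℂ) := by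
  rw [R, tsum_eq_single 0]
  · simp
  · intro m hm
    simp [hm]

/-- For `t ≠ 0` the function is `(e^{-ity} - 1) / (-it)`; the case `t = 0` is separate because of
the division. -/
theorem hasDerivAt_mul_R_one (t x : ℝ) :
    HasDerivAt (fun y : ℝ => (y : ℂ) * R 1 (-t * y)) (Complex.exp (-(Complex.I * t * x))) x := by
  rcases eq_or_ne t 0 with rfl | ht
  · have h : (fun y : ℝ => (y : ℂ) * R 1 (-0 * y)) = fun y : ℝ => (y : ℂ) := by
      ext y
      simp [R_zero]
    rw [h]
    simpa using (hasDerivAt_id (x : ℝ)).ofReal_comp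
  · have ht' : (t : ℂ) ≠ 0 := by exact_mod_cast ht
    have h : (fun y : ℝ => (y : ℂ) * R 1 (-t * y))
        = fun y : ℝ => (Complex.exp (-(Complex.I * t) * y) - 1) / (-(Complex.I * t)) := by
      ext y
      have h1 := I_mul_R_one (-t * y)
      rw [eq_div_iff (by simp [ht'])]
      push_cast at h1
      rw [show -(Complex.I * t) * (y : ℂ) = Complex.I * (-t * y) by ring, ← h1]
      ring
    rw [h]
    have h2 : HasDerivAt (fun y : ℝ => -(Complex.I * t) * (y : ℂ)) (-(Complex.I * t)) x := by
      simpa using ((hasDerivAt_id x).ofReal_comp).const_mul (-(Complex.I * t))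
    refine ((h2.cexp.sub_const 1).div_const (-(Complex.I * t))).congr_deriv ?_
    rw [mul_div_assoc, div_self (by simp [ht']), mul_one, neg_mul]

theorem hasDerivAt_sq_mul_R_two (t x : ℝ) :
    HasDerivAt (fun y : ℝ => (y : ℂ) ^ 2 * R 2 (-t * y)) (x * R 1 (-t * x)) x := by
  have hid : HasDerivAt (fun y : ℝ => (y : ℂ)) 1 x := by
    simpa using (hasDerivAt_id x).ofReal_comp
  rcases eq_or_ne t 0 with rfl | ht
  · have h : (fun y : ℝ => (y : ℂ) ^ 2 * R 2 (-0 * y)) = fun y : ℝ => (y : ℂ) ^ 2 / 2 := by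
      ext y
      simp [R_zero]
      ring
    rw [h]
    refine ((hid.pow 2).div_const 2).congr_deriv ?_
    simp [R_zero]
  · have ht' : (t : ℂ) ≠ 0 := by exact_mod_cast ht
    have h : (fun y : ℝ => (y : ℂ) ^ 2 * R 2 (-t * y))
        = fun y : ℝ => (Complex.exp (-(Complex.I * t) * y) - 1 + Complex.I * t * y)
          / (-(t : ℂ) ^ 2) := by
      ext y
      have h1 := I_mul_sq_mul_R_two (-t * y)
      rw [eq_div_iff (by simp [ht'])]
      push_cast at h1
      rw [show -(Complex.I * t) * (y : ℂ) = Complex.I * (-t * y) by ring,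
        show Complex.I * t * (y : ℂ) = -(Complex.I * (-t * y)) by ring, ← sub_eq_add_neg, ← h1,
        mul_pow, Complex.I_sq]
      ring
    rw [h]
    have h2 : HasDerivAt (fun y : ℝ => -(Complex.I * t) * (y : ℂ)) (-(Complex.I * t)) x := by
      simpa using hid.const_mul (-(Complex.I * t))
    have h3 : HasDerivAt (fun y : ℝ => Complex.I * t * (y : ℂ)) (Complex.I * t) x := by
      simpa using hid.const_mul (Complex.I * t)
    refine (((h2.cexp.sub_const 1).add h3).div_const (-(t : ℂ) ^ 2)).congr_deriv ?_
    have h1 := I_mul_R_one (-t * x)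
    push_cast at h1
    rw [div_eq_iff (by simp [ht']),
      show -(Complex.I * t) * (x : ℂ) = Complex.I * (-t * x) by ring]
    have h4 : Complex.exp (Complex.I * (-t * x)) = 1 + Complex.I * (-t * x) * R 1 (-t * x) := by
      rw [h1]
      ring
    rw [h4]
    ring_nf
    rw [Complex.I_sq]
    ring

theorem norm_mul_R_one_sub_le (t x y : ℝ) :
    ‖(y : ℂ) * R 1 (-t * y) - x * R 1 (-t * x)‖ ≤ |y - x| := by
  have h := convex_univ.norm_image_sub_le_of_norm_hasDerivWithin_le (C := 1)
    (fun z _ => (hasDerivAt_mul_R_one t z).hasDerivWithinAt)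
    (fun z _ => by
      rw [show -(Complex.I * t * z) = ((-(t * z) : ℝ) : ℂ) * Complex.I by push_cast; ring,
        Complex.norm_exp_ofReal_mul_I]) (Set.mem_univ x) (Set.mem_univ y)
  simpa using h

theorem norm_mul_R_one_le (t x : ℝ) : ‖(x : ℂ) * R 1 (-t * x)‖ ≤ |x| := by
  simpa using norm_mul_R_one_sub_le t 0 x

/-- The derivative `z R_1(-tz)` has norm at most `|z| ≤ r` on the interval, so the mean value
inequality applies. -/
theorem norm_sq_mul_R_two_sub_le {r : ℝ} (t : ℝ) {x y : ℝ} (hx : |x| ≤ r) (hy : |y| ≤ r) :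
    ‖(y : ℂ) ^ 2 * R 2 (-t * y) - (x : ℂ) ^ 2 * R 2 (-t * x)‖ ≤ r * |y - x| := by
  exact (convex_Icc (-r) r).norm_image_sub_le_of_norm_hasDerivWithin_le
    (fun z _ => (hasDerivAt_sq_mul_R_two t z).hasDerivWithinAt)
    (fun z hz => (norm_mul_R_one_le t z).trans (abs_le.2 hz)) (abs_le.1 hx) (abs_le.1 hy)

theorem norm_sq_mul_R_two_le {r : ℝ} (t : ℝ) {x : ℝ} (hx : |x| ≤ r) :
    ‖(x : ℂ) ^ 2 * R 2 (-t * x)‖ ≤ r ^ 2 := by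
  have h0 : 0 ≤ r := (abs_nonneg x).trans hx
  have h := norm_sq_mul_R_two_sub_le (r := r) t (x := 0) (by simpa using h0) hx
  simp only [Complex.ofReal_zero, ne_eq, OfNat.ofNat_ne_zero, not_false_eq_true, zero_pow,
    zero_mul, sub_zero] at h
  nlinarith

end Remainder

theorem measurable_Y {Ω : Type*} {n : ℕ} {I : Edge n → Ω → ℝ} {m : MeasurableSpace Ω}
    (A : Finset (Edge n)) (h : ∀ e ∈ A, Measurable[m] (I e)) : Measurable[m] (Y I A) :=
  Finset.measurable_fun_prod A h

theorem measurable_Y_iSup {Ω : Type*} {n : ℕ} (I : Edge n → Ω → ℝ) {A B : Finset (Edge n)} (h : A ⊆ B) :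
    Measurable[⨆ e ∈ (B : Set (Edge n)), MeasurableSpace.comap (I e) inferInstance] (Y I A) :=
  measurable_Y A fun e he => Measurable.mono (comap_measurable (I e))
    (le_iSup₂_of_le (f := fun e (_ : e ∈ (B : Set (Edge n))) =>
      MeasurableSpace.comap (I e) inferInstance) e (Finset.mem_coe.2 (h he)) le_rfl) le_rfl

/-! ### Products of edge indicators -/

section Products

variable {Ω : Type*} [MeasurableSpace Ω] {n : ℕ} {I : Edge n → Ω → ℝ} {μ : Measure Ω} {p : ℝ}

theorem IsBernoulliFamily.Y_eq (hI : IsBernoulliFamily I μ p) (A : Finset (Edge n)) (ω : Ω) :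
    Y I A ω = 0 ∨ Y I A ω = 1 := by
  by_cases h : ∃ e ∈ A, I e ω = 0
  · obtain ⟨e, he, h0⟩ := h
    exact Or.inl (Finset.prod_eq_zero he h0)
  · push Not at h
    exact Or.inr (Finset.prod_eq_one fun e he => (hI.ind e ω).resolve_left (h e he))

theorem IsBernoulliFamily.Y_nonneg (hI : IsBernoulliFamily I μ p) (A : Finset (Edge n)) (ω : Ω) :
    0 ≤ Y I A ω := by
  rcases hI.Y_eq A ω with h | h <;> simp [h]

theorem IsBernoulliFamily.Y_le_one (hI : IsBernoulliFamily I μ p) (A : Finset (Edge n)) (ω : Ω) :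
    Y I A ω ≤ 1 := by
  rcases hI.Y_eq A ω with h | h <;> simp [h]

theorem IsBernoulliFamily.Y_mono (hI : IsBernoulliFamily I μ p) (A : Finset (Edge n)) {ω ω' : Ω}
    (h : ∀ e, I e ω ≤ I e ω') : Y I A ω ≤ Y I A ω' :=
  Finset.prod_le_prod (fun e _ => by rcases hI.ind e ω with h | h <;> simp [h]) fun e _ => h e

/-- Indicators are idempotent, so the edges common to `A` and `B` need to be counted only once. -/
theorem IsBernoulliFamily.Y_mul_Y (hI : IsBernoulliFamily I μ p) (A B : Finset (Edge n)) (ω : Ω) :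
    Y I A ω * Y I B ω = Y I (A ∪ B) ω := by
  have hsq : (∏ e ∈ A ∩ B, I e ω) * (∏ e ∈ A ∩ B, I e ω) = ∏ e ∈ A ∩ B, I e ω := by
    rw [← Finset.prod_mul_distrib]
    refine Finset.prod_congr rfl fun e _ => ?_
    rcases hI.ind e ω with h | h <;> simp [h]
  have hAB : (∏ e ∈ A ∪ B, I e ω) * (∏ e ∈ A ∩ B, I e ω) = ∏ e ∈ A ∪ B, I e ω := by
    rw [← Finset.sdiff_union_of_subset (Finset.inter_subset_left.trans
      (Finset.subset_union_left (s₁ := A) (s₂ := B)) : A ∩ B ⊆ A ∪ B),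
      Finset.prod_union Finset.sdiff_disjoint, mul_assoc, hsq]
  rw [Y, Y, Y, ← Finset.prod_union_inter, hAB]

theorem IsBernoulliFamily.p_nonneg (hI : IsBernoulliFamily I μ p) (e : Edge n) : 0 ≤ p := by
  rw [← hI.law e]
  exact measureReal_nonneg

theorem IsBernoulliFamily.integral_Y (hI : IsBernoulliFamily I μ p) (A : Finset (Edge n)) :
    ∫ ω, Y I A ω ∂μ = p ^ A.card := by
  have h : Y I A = (⋂ e ∈ A, I e ⁻¹' {1}).indicator 1 := by
    ext ω
    by_cases hω : ω ∈ ⋂ e ∈ A, I e ⁻¹' {1}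
    · rw [Set.indicator_of_mem hω]
      exact Finset.prod_eq_one fun e he => by simpa using Set.mem_iInter₂.1 hω e he
    · rw [Set.indicator_of_notMem hω]
      simp only [Set.mem_iInter, not_forall] at hω
      obtain ⟨e, he, h⟩ := hω
      exact Finset.prod_eq_zero he ((hI.ind e ω).resolve_right h)
  rw [h, integral_indicator_one
    (Finset.measurableSet_biInter A fun e _ => hI.meas e (measurableSet_singleton 1)),
    hI.real_iInter A fun _ => 1, Finset.prod_congr rfl fun e _ => hI.real_one e, Finset.prod_const]

theorem IsBernoulliFamily.indepFun_of_disjoint (hI : IsBernoulliFamily I μ p)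
    {A B : Finset (Edge n)} (hAB : Disjoint A B) {F G : Ω → ℝ}
    (hF : Measurable[⨆ e ∈ (A : Set (Edge n)), MeasurableSpace.comap (I e) inferInstance] F)
    (hG : Measurable[⨆ e ∈ (B : Set (Edge n)), MeasurableSpace.comap (I e) inferInstance] G) :
    IndepFun F G μ := by
  have h := indep_iSup_of_disjoint (fun e => (hI.meas e).comap_le) hI.indep
    (Finset.disjoint_coe.2 hAB)
  rw [IndepFun_iff_Indep]
  exact indep_of_indep_of_le_left (indep_of_indep_of_le_right h hG.comap_le) hF.comap_le

variable [IsProbabilityMeasure μ]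

theorem IsBernoulliFamily.p_le_one (hI : IsBernoulliFamily I μ p) (e : Edge n) : p ≤ 1 := by
  rw [← hI.law e]
  exact measureReal_le_one

theorem IsBernoulliFamily.memLp (hI : IsBernoulliFamily I μ p) {F : Ω → ℝ}
    (hF : ∀ ω ω', (∀ e, I e ω = I e ω') → F ω = F ω') : MemLp F 2 μ := by
  have hfac : F.FactorsThrough (present I) := fun ω ω' h =>
    hF ω ω' fun e => le_antisymm (hI.present_subset h.le e) (hI.present_subset h.ge e)
  obtain ⟨φ, rfl⟩ := (Function.factorsThrough_iff F).1 hfac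
  refine MemLp.of_bound (hI.integral_present φ).1.aestronglyMeasurable (∑ T, ‖φ T‖)
    (Filter.Eventually.of_forall fun ω => ?_)
  exact Finset.single_le_sum (f := fun T => ‖φ T‖) (fun T _ => norm_nonneg _) (Finset.mem_univ _)

theorem IsBernoulliFamily.integrable (hI : IsBernoulliFamily I μ p) {F : Ω → ℝ}
    (hF : ∀ ω ω', (∀ e, I e ω = I e ω') → F ω = F ω') : Integrable F μ :=
  (hI.memLp hF).integrable (by norm_num)

theorem IsBernoulliFamily.memLp_Y (hI : IsBernoulliFamily I μ p) (A : Finset (Edge n)) :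
    MemLp (Y I A) 2 μ :=
  hI.memLp fun ω ω' h => by simp only [Y, h]

theorem IsBernoulliFamily.covariance_Y (hI : IsBernoulliFamily I μ p) (A B : Finset (Edge n)) :
    cov[Y I A, Y I B; μ] = p ^ (A ∪ B).card - p ^ A.card * p ^ B.card := by
  rw [covariance_eq_sub (hI.memLp_Y A) (hI.memLp_Y B)]
  simp only [Pi.mul_apply, hI.Y_mul_Y, hI.integral_Y]

end Products

/-! ### Dependence between copies -/

section Copies

variable {V Ω : Type*} [MeasurableSpace Ω] {Γ : SimpleGraph V} {n : ℕ} {I : Edge n → Ω → ℝ}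
  {μ : Measure Ω} {p : ℝ}

theorem mem_N_iff {j k : Finset (Edge n)} :
    k ∈ N Γ μ I j ↔ k ∈ copies Γ n ∧ ¬ IndepFun (X Γ μ I j) (X Γ μ I k) μ := by
  simp [N]

theorem mem_copies_of_mem_N {j k : Finset (Edge n)} (h : k ∈ N Γ μ I j) : k ∈ copies Γ n :=
  (mem_N_iff.1 h).1

theorem mem_N_symm {j k : Finset (Edge n)} (hj : j ∈ copies Γ n) (h : k ∈ N Γ μ I j) :
    j ∈ N Γ μ I k :=
  mem_N_iff.2 ⟨hj, fun h' => (mem_N_iff.1 h).2 h'.symm⟩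

theorem card_N_le {j : Finset (Edge n)} (hj : j ∈ copies Γ n) : (N Γ μ I j).card ≤ D Γ μ I :=
  Finset.le_sup (f := fun j => (N Γ μ I j).card) hj

variable [IsProbabilityMeasure μ]

/-- At `p = 0` and `p = 1` all covariances `p ^ |j ∪ k| - p ^ |j| p ^ |k|` vanish, which contradicts
`σ > 0`. -/
theorem IsBernoulliFamily.p_pos (hI : IsBernoulliFamily I μ p) (hσ : 0 < sigma Γ μ I) :
    0 < p ∧ p < 1 := by
  have hvar : 0 < variance (fun ω => ∑ j ∈ copies Γ n, Y I j ω) μ := Real.sqrt_pos.1 hσ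
  rw [variance_fun_sum' fun j _ => hI.memLp_Y j] at hvar
  simp only [hI.covariance_Y] at hvar
  -- Without edges nothing ties `p` to a probability, but then the count is constant and its
  -- variance is zero.
  obtain ⟨e⟩ : Nonempty (Edge n) := by
    by_contra h
    rw [not_nonempty_iff] at h
    simp [Finset.eq_empty_of_isEmpty] at hvar
  refine ⟨(hI.p_nonneg e).lt_of_ne ?_, (hI.p_le_one e).lt_of_ne ?_⟩
  · rintro rfl
    refine hvar.ne' (Finset.sum_eq_zero fun j _ => Finset.sum_eq_zero fun k _ => ?_)
    simp only [zero_pow_eq, Finset.card_eq_zero, Finset.union_eq_empty]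
    split_ifs <;> simp_all
  · rintro rfl
    simp at hvar

theorem covariance_X (hI : IsBernoulliFamily I μ p) (j k : Finset (Edge n)) :
    ∫ ω, X Γ μ I j ω * X Γ μ I k ω ∂μ
      = (sigma Γ μ I)⁻¹ ^ 2 * (p ^ (j ∪ k).card - p ^ j.card * p ^ k.card) := by
  rw [← hI.covariance_Y, covariance, ← integral_const_mul]
  refine integral_congr_ae (Filter.Eventually.of_forall fun ω => ?_)
  simp only [X]
  ring

theorem integral_X (hI : IsBernoulliFamily I μ p) (j : Finset (Edge n)) :
    ∫ ω, X Γ μ I j ω ∂μ = 0 := by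
  simp only [X]
  rw [integral_const_mul, integral_sub ((hI.memLp_Y j).integrable (by norm_num))
    (integrable_const _)]
  simp

theorem IsBernoulliFamily.memLp_X (hI : IsBernoulliFamily I μ p) (j : Finset (Edge n)) :
    MemLp (X Γ μ I j) 2 μ :=
  hI.memLp fun ω ω' h => by simp only [X, Y, h]

theorem IsBernoulliFamily.integral_X_mul_X_eq_zero (hI : IsBernoulliFamily I μ p)
    {j k : Finset (Edge n)} (hk : k ∈ copies Γ n) (h : k ∉ N Γ μ I j) :
    ∫ ω, X Γ μ I j ω * X Γ μ I k ω ∂μ = 0 := by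
  have h' : IndepFun (X Γ μ I j) (X Γ μ I k) μ := by
    by_contra h'
    exact h (mem_N_iff.2 ⟨hk, h'⟩)
  rw [h'.integral_fun_mul_eq_mul_integral (hI.memLp_X j).aestronglyMeasurable
    (hI.memLp_X k).aestronglyMeasurable, integral_X hI, zero_mul]

/-- A common edge makes `|j ∪ k| < |j| + |k|`, so the covariance is strictly positive. Used
contrapositively: copies outside `N_j` are edge-disjoint from `j`. -/
theorem IsBernoulliFamily.mem_N (hI : IsBernoulliFamily I μ p) (hσ : 0 < sigma Γ μ I)
    {j k : Finset (Edge n)} (hk : k ∈ copies Γ n) (hjk : ¬ Disjoint j k) : k ∈ N Γ μ I j := by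
  by_contra h
  have h0 := hI.integral_X_mul_X_eq_zero hk h
  obtain ⟨hp0, hp1⟩ := hI.p_pos hσ
  have hcard : (j ∪ k).card < j.card + k.card := by
    have h1 := Finset.card_union_add_card_inter j k
    have h2 : 0 < (j ∩ k).card :=
      Finset.card_pos.2 (Finset.not_disjoint_iff_nonempty_inter.1 hjk)
    omega
  have hlt := pow_lt_pow_right_of_lt_one₀ hp0 hp1 hcard
  rw [covariance_X hI, ← pow_add] at h0
  have : 0 < (sigma Γ μ I)⁻¹ ^ 2 * (p ^ (j ∪ k).card - p ^ (j.card + k.card)) :=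
    mul_pos (by positivity) (sub_pos.2 hlt)
  exact this.ne' h0

end Copies

/-- As `U` is centred, the mean of `V` may be dropped. What remains is at most `E|U - E U|`, whose
square is bounded through the nonnegativity of a variance. -/
theorem norm_complexCov_le {Ω : Type*} [MeasurableSpace Ω] {μ : Measure Ω} [IsProbabilityMeasure μ]
    {U V : Ω → ℂ} (hU : Integrable U μ) (hU2 : Integrable (fun ω => ‖U ω - ∫ x, U x ∂μ‖ ^ 2) μ)
    (hV : AEStronglyMeasurable V μ) (hV1 : ∀ ω, ‖V ω‖ ≤ 1) :
    ‖complexCov μ U V‖ ^ 2 ≤ ∫ ω, ‖U ω - ∫ x, U x ∂μ‖ ^ 2 ∂μ := by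
  set m := ∫ x, U x ∂μ with hm
  have hc : Integrable (fun ω => U ω - m) μ := hU.sub (integrable_const m)
  have hc0 : ∫ ω, (U ω - m) ∂μ = 0 := by
    rw [integral_sub hU (integrable_const m)]
    simp [hm]
  have hcV : Integrable (fun ω => (U ω - m) * conj (V ω)) μ :=
    hc.mul_bdd (c := 1) (Complex.continuous_conj.comp_aestronglyMeasurable hV)
      (Filter.Eventually.of_forall fun ω => by simpa using hV1 ω)
  have h1 : complexCov μ U V = ∫ ω, (U ω - m) * conj (V ω) ∂μ := by
    rw [complexCov, ← hm]
    simp only [map_sub, mul_sub]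
    rw [integral_sub hcV (hc.mul_const _), integral_mul_const, hc0, zero_mul, sub_zero]
  have h2 : ‖complexCov μ U V‖ ≤ ∫ ω, ‖U ω - m‖ ∂μ := by
    rw [h1]
    refine norm_integral_le_of_norm_le hc.norm (Filter.Eventually.of_forall fun ω => ?_)
    rw [norm_mul, RCLike.norm_conj]
    exact mul_le_of_le_one_right (norm_nonneg _) (hV1 ω)
  have h3 : MemLp (fun ω => ‖U ω - m‖) 2 μ :=
    (memLp_two_iff_integrable_sq hc.norm.aestronglyMeasurable).2 hU2
  have h4 := variance_nonneg (fun ω => ‖U ω - m‖) μ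
  rw [variance_eq_sub h3] at h4
  calc ‖complexCov μ U V‖ ^ 2 ≤ (∫ ω, ‖U ω - m‖ ∂μ) ^ 2 := by gcongr
    _ ≤ _ := sub_nonneg.1 h4

/-! ### Increments of `H_t` and the bound with `D` -/

section Increments

variable {V Ω : Type*} [MeasurableSpace Ω] {Γ : SimpleGraph V} {n : ℕ} {I : Edge n → Ω → ℝ}
  {μ : Measure Ω} {p : ℝ}

/-- `Z_j`, the sum of the summands in the neighbourhood of `j`. -/
noncomputable def Zj (Γ : SimpleGraph V) (μ : Measure Ω) (I : Edge n → Ω → ℝ)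
    (j : Finset (Edge n)) (ω : Ω) : ℝ :=
  ∑ k ∈ N Γ μ I j, X Γ μ I k ω

theorem H_eq (t : ℝ) (ω : Ω) :
    H Γ μ I t ω
      = Complex.I * ∑ j ∈ copies Γ n,
          (X Γ μ I j ω : ℂ) * ((Zj Γ μ I j ω : ℂ) ^ 2 * R 2 (-t * Zj Γ μ I j ω))
        - Complex.I * ∑ j ∈ copies Γ n, ∑ k ∈ N Γ μ I j,
          ((X Γ μ I j ω * X Γ μ I k ω - ∫ x, X Γ μ I j x * X Γ μ I k x ∂μ : ℝ) : ℂ)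
            * (((Zj Γ μ I j ω + Vjk Γ μ I j k ω : ℝ) : ℂ)
              * R 1 (-t * (Zj Γ μ I j ω + Vjk Γ μ I j k ω))) := by
  simp only [H, decompositionProcess, Zj]
  congr 2
  · refine Finset.sum_congr rfl fun j _ => ?_
    push_cast
    ring
  · refine Finset.sum_congr rfl fun j _ => Finset.sum_congr rfl fun k _ => ?_
    rw [Complex.ofReal_mul, mul_assoc]

theorem norm_H_sub_le (t : ℝ) (ω ω' : Ω) {a : Finset (Edge n) → ℝ}
    {b : Finset (Edge n) → Finset (Edge n) → ℝ}
    (ha : ∀ j ∈ copies Γ n,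
      ‖(X Γ μ I j ω' : ℂ) * ((Zj Γ μ I j ω' : ℂ) ^ 2 * R 2 (-t * Zj Γ μ I j ω'))
        - (X Γ μ I j ω : ℂ) * ((Zj Γ μ I j ω : ℂ) ^ 2 * R 2 (-t * Zj Γ μ I j ω))‖ ≤ a j)
    (hb : ∀ j ∈ copies Γ n, ∀ k ∈ N Γ μ I j,
      ‖((X Γ μ I j ω' * X Γ μ I k ω' - ∫ x, X Γ μ I j x * X Γ μ I k x ∂μ : ℝ) : ℂ)
            * (((Zj Γ μ I j ω' + Vjk Γ μ I j k ω' : ℝ) : ℂ)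
              * R 1 (-t * (Zj Γ μ I j ω' + Vjk Γ μ I j k ω')))
        - ((X Γ μ I j ω * X Γ μ I k ω - ∫ x, X Γ μ I j x * X Γ μ I k x ∂μ : ℝ) : ℂ)
            * (((Zj Γ μ I j ω + Vjk Γ μ I j k ω : ℝ) : ℂ)
              * R 1 (-t * (Zj Γ μ I j ω + Vjk Γ μ I j k ω)))‖ ≤ b j k) :
    ‖H Γ μ I t ω' - H Γ μ I t ω‖
      ≤ ∑ j ∈ copies Γ n, a j + ∑ j ∈ copies Γ n, ∑ k ∈ N Γ μ I j, b j k := by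
  rw [H_eq, H_eq, sub_sub_sub_comm, ← mul_sub, ← mul_sub, ← Finset.sum_sub_distrib,
    ← Finset.sum_sub_distrib]
  refine (norm_sub_le _ _).trans (add_le_add ?_ ?_)
  · rw [norm_mul, Complex.norm_I, one_mul]
    exact norm_sum_le_of_le _ ha
  · rw [norm_mul, Complex.norm_I, one_mul]
    refine norm_sum_le_of_le _ fun j hj => ?_
    rw [← Finset.sum_sub_distrib]
    exact norm_sum_le_of_le _ (hb j hj)

/-- One factor is bounded at the new point, the other at the old one. With monotone majorants the
bound has the form `A'(B' - B) + (A' - A)B = A'B' - AB`, again an increment. -/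
theorem norm_mul_sub_mul_le (a a' b b' : ℂ) {A B α β : ℝ} (ha' : ‖a'‖ ≤ A) (hb : ‖b‖ ≤ B)
    (hα : ‖a' - a‖ ≤ α) (hβ : ‖b' - b‖ ≤ β) : ‖a' * b' - a * b‖ ≤ A * β + α * B := by
  have h : a' * b' - a * b = a' * (b' - b) + (a' - a) * b := by ring
  rw [h]
  refine (norm_add_le _ _).trans ?_
  rw [norm_mul, norm_mul]
  have := norm_nonneg a'
  have := norm_nonneg b
  have := (norm_nonneg _).trans hα
  have := (norm_nonneg _).trans hβ
  gcongr
  exact le_trans ‹_› ha'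

theorem sum_sum_N_left_le {g : Finset (Edge n) → ℝ} (hg : ∀ j, 0 ≤ g j) :
    ∑ j ∈ copies Γ n, ∑ _k ∈ N Γ μ I j, g j ≤ D Γ μ I * ∑ j ∈ copies Γ n, g j := by
  rw [Finset.mul_sum]
  refine Finset.sum_le_sum fun j hj => ?_
  rw [Finset.sum_const, nsmul_eq_mul]
  exact mul_le_mul_of_nonneg_right (by exact_mod_cast card_N_le hj) (hg j)

/-- Dependence is symmetric, so the order of summation can be exchanged. -/
theorem sum_sum_N_right_le {g : Finset (Edge n) → ℝ} (hg : ∀ j, 0 ≤ g j) :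
    ∑ j ∈ copies Γ n, ∑ k ∈ N Γ μ I j, g k ≤ D Γ μ I * ∑ j ∈ copies Γ n, g j := by
  rw [Finset.sum_comm' (t' := copies Γ n) (s' := fun k => N Γ μ I k)]
  · exact sum_sum_N_left_le hg
  · intro j k
    exact ⟨fun h => ⟨mem_N_symm h.1 h.2, mem_copies_of_mem_N h.2⟩,
      fun h => ⟨mem_copies_of_mem_N h.1, mem_N_symm h.2 h.1⟩⟩

theorem abs_Vjk_le_sum {g : Finset (Edge n) → ℝ} {ω : Ω} (hg : ∀ j, |X Γ μ I j ω| ≤ g j)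
    (j k : Finset (Edge n)) : |Vjk Γ μ I j k ω| ≤ ∑ l ∈ N Γ μ I k, g l := by
  classical
  refine (Finset.abs_sum_le_sum_abs _ _).trans ((Finset.sum_le_sum fun l _ => hg l).trans ?_)
  exact Finset.sum_le_sum_of_subset_of_nonneg Finset.sdiff_subset
    fun l _ _ => (abs_nonneg _).trans (hg l)

theorem abs_Vjk_sub_le_sum {g : Finset (Edge n) → ℝ} {ω ω' : Ω}
    (hg : ∀ j, |X Γ μ I j ω' - X Γ μ I j ω| ≤ g j) (j k : Finset (Edge n)) :
    |Vjk Γ μ I j k ω' - Vjk Γ μ I j k ω| ≤ ∑ l ∈ N Γ μ I k, g l := by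
  classical
  rw [Vjk, Vjk, ← Finset.sum_sub_distrib]
  refine (Finset.abs_sum_le_sum_abs _ _).trans ((Finset.sum_le_sum fun l _ => hg l).trans ?_)
  exact Finset.sum_le_sum_of_subset_of_nonneg Finset.sdiff_subset
    fun l _ _ => (abs_nonneg _).trans (hg l)

theorem abs_Zj_sub_le_sum {g : Finset (Edge n) → ℝ} {ω ω' : Ω}
    (hg : ∀ j, |X Γ μ I j ω' - X Γ μ I j ω| ≤ g j) (j : Finset (Edge n)) :
    |Zj Γ μ I j ω' - Zj Γ μ I j ω| ≤ ∑ l ∈ N Γ μ I j, g l := by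
  rw [Zj, Zj, ← Finset.sum_sub_distrib]
  exact Finset.abs_sum_le_sum_abs _ _ |>.trans (Finset.sum_le_sum fun l _ => hg l)

theorem IsBernoulliFamily.abs_X_sub (hI : IsBernoulliFamily I μ p) (hσ : 0 < sigma Γ μ I)
    {ω ω' : Ω} (h : ∀ e, I e ω ≤ I e ω') (j : Finset (Edge n)) :
    |X Γ μ I j ω' - X Γ μ I j ω| = (sigma Γ μ I)⁻¹ * (Y I j ω' - Y I j ω) := by
  rw [X, X, ← mul_sub, sub_sub_sub_cancel_right, abs_of_nonneg]
  exact mul_nonneg (inv_nonneg.2 hσ.le) (sub_nonneg.2 (hI.Y_mono j h))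

theorem IsBernoulliFamily.measurable_X (hI : IsBernoulliFamily I μ p) (j : Finset (Edge n)) :
    Measurable (X Γ μ I j) :=
  ((measurable_Y j fun e _ => hI.meas e).sub_const _).const_mul _

variable [IsProbabilityMeasure μ]

theorem IsBernoulliFamily.integral_Y_mem (hI : IsBernoulliFamily I μ p) (j : Finset (Edge n)) :
    0 ≤ ∫ ω, Y I j ω ∂μ ∧ ∫ ω, Y I j ω ∂μ ≤ 1 := by
  refine ⟨integral_nonneg fun ω => hI.Y_nonneg j ω, ?_⟩
  refine (integral_mono ((hI.memLp_Y j).integrable (by norm_num)) (integrable_const 1)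
    fun ω => hI.Y_le_one j ω).trans_eq (by simp)

theorem IsBernoulliFamily.abs_X_le (hI : IsBernoulliFamily I μ p) (hσ : 0 < sigma Γ μ I)
    (j : Finset (Edge n)) (ω : Ω) : |X Γ μ I j ω| ≤ (sigma Γ μ I)⁻¹ := by
  rw [X, abs_mul, abs_of_pos (inv_pos.2 hσ)]
  refine mul_le_of_le_one_right (inv_nonneg.2 hσ.le) (abs_le.2 ?_)
  have h1 := hI.integral_Y_mem j
  have h2 := hI.Y_nonneg j ω
  have h3 := hI.Y_le_one j ω
  constructor <;> linarith

theorem IsBernoulliFamily.norm_H_sub_le_mul (hI : IsBernoulliFamily I μ p) (hσ : 0 < sigma Γ μ I)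
    (t : ℝ) {ω ω' : Ω} (h : ∀ e, I e ω ≤ I e ω') :
    ‖H Γ μ I t ω' - H Γ μ I t ω‖
      ≤ 10 * (D Γ μ I : ℝ) ^ 2 * (sigma Γ μ I)⁻¹ ^ 3
        * ∑ j ∈ copies Γ n, (Y I j ω' - Y I j ω) := by
  set u := (sigma Γ μ I)⁻¹ with hu
  set d : ℝ := (D Γ μ I : ℝ) with hd
  have hu0 : 0 ≤ u := inv_nonneg.2 hσ.le
  have hd0 : 0 ≤ d := Nat.cast_nonneg _
  set δ : Finset (Edge n) → ℝ := fun j => Y I j ω' - Y I j ω with hδ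
  set s : Finset (Edge n) → ℝ := fun j => ∑ k ∈ N Γ μ I j, δ k with hs
  have hδ0 : ∀ j, 0 ≤ δ j := fun j => sub_nonneg.2 (hI.Y_mono j h)
  have hs0 : ∀ j, 0 ≤ s j := fun j => Finset.sum_nonneg fun k _ => hδ0 k
  have hX : ∀ j ω, |X Γ μ I j ω| ≤ u := hI.abs_X_le hσ
  have hΔX : ∀ j, |X Γ μ I j ω' - X Γ μ I j ω| ≤ u * δ j := fun j => (hI.abs_X_sub hσ h j).le
  have hcard : ∀ j ∈ copies Γ n, ∑ _k ∈ N Γ μ I j, u ≤ d * u := fun j hj => by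
    rw [Finset.sum_const, nsmul_eq_mul]
    exact mul_le_mul_of_nonneg_right (Nat.cast_le.2 (card_N_le hj)) hu0
  have hZ : ∀ j ∈ copies Γ n, ∀ ω, |Zj Γ μ I j ω| ≤ d * u := fun j hj ω =>
    (Finset.abs_sum_le_sum_abs _ _).trans
      ((Finset.sum_le_sum fun k _ => hX k ω).trans (hcard j hj))
  have hΔZ : ∀ j, |Zj Γ μ I j ω' - Zj Γ μ I j ω| ≤ u * s j := fun j =>
    (abs_Zj_sub_le_sum hΔX j).trans_eq (Finset.mul_sum _ _ _).symm
  have hS : ∀ j ∈ copies Γ n, ∀ k ∈ copies Γ n, ∀ ω,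
      |Zj Γ μ I j ω + Vjk Γ μ I j k ω| ≤ 2 * d * u := fun j hj k hk ω => by
    refine (abs_add_le _ _).trans ?_
    have h1 := hZ j hj ω
    have h2 := (abs_Vjk_le_sum (fun l => hX l ω) j k).trans (hcard k hk)
    linarith
  have hΔS : ∀ j k, |Zj Γ μ I j ω' + Vjk Γ μ I j k ω' - (Zj Γ μ I j ω + Vjk Γ μ I j k ω)|
      ≤ u * (s j + s k) := fun j k => by
    rw [add_sub_add_comm]
    refine (abs_add_le _ _).trans ?_
    have h1 := hΔZ j
    have h2 := (abs_Vjk_sub_le_sum hΔX j k).trans_eq (Finset.mul_sum _ _ _).symm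
    linarith
  have hXX : ∀ j k ω, |X Γ μ I j ω * X Γ μ I k ω| ≤ u ^ 2 := fun j k ω => by
    rw [abs_mul, sq]
    exact mul_le_mul (hX j ω) (hX k ω) (abs_nonneg _) hu0
  have hE : ∀ j k, |∫ x, X Γ μ I j x * X Γ μ I k x ∂μ| ≤ u ^ 2 := fun j k => by
    simpa using norm_integral_le_of_norm_le_const (μ := μ)
      (f := fun ω => X Γ μ I j ω * X Γ μ I k ω)
      (Filter.Eventually.of_forall fun ω => hXX j k ω)
  refine (norm_H_sub_le t ω ω' (a := fun j => u * (d * u * (u * s j)) + u * δ j * (d * u) ^ 2)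
    (b := fun j k => 2 * u ^ 2 * (u * (s j + s k)) + (u * (u * δ k) + u * δ j * u) * (2 * d * u))
    ?_ ?_).trans ?_
  · intro j hj
    refine norm_mul_sub_mul_le _ _ _ _ (by simpa using hX j ω')
      (norm_sq_mul_R_two_le t (hZ j hj ω)) ?_ ?_
    · rw [← Complex.ofReal_sub, Complex.norm_real]
      exact hΔX j
    · refine (norm_sq_mul_R_two_sub_le t (hZ j hj ω) (hZ j hj ω')).trans ?_
      exact mul_le_mul_of_nonneg_left (hΔZ j) (mul_nonneg hd0 hu0)
  · intro j hj k hk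
    refine norm_mul_sub_mul_le _ _ _ _ ?_
      ((norm_mul_R_one_le t _).trans (hS j hj k (mem_copies_of_mem_N hk) ω)) ?_
      ((norm_mul_R_one_sub_le t _ _).trans (hΔS j k))
    · rw [Complex.norm_real]
      refine (abs_sub _ _).trans ?_
      linarith [hXX j k ω', hE j k]
    · rw [← Complex.ofReal_sub, sub_sub_sub_cancel_right]
      push_cast
      refine norm_mul_sub_mul_le _ _ _ _ (by simpa using hX j ω') (by simpa using hX k ω) ?_ ?_
      · rw [← Complex.ofReal_sub, Complex.norm_real]
        exact hΔX j
      · rw [← Complex.ofReal_sub, Complex.norm_real]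
        exact hΔX k
  -- Each sum over a neighbourhood costs a factor `d`. In units of `d² u³ ∑ δ`, the first part of
  -- `H_t` contributes `1 + 1` and the second `4 + 4`, which is the constant `10`.
  · have e1 : ∑ j ∈ copies Γ n, s j ≤ d * ∑ j ∈ copies Γ n, δ j := sum_sum_N_right_le hδ0
    have e2 : ∑ j ∈ copies Γ n, ∑ _k ∈ N Γ μ I j, s j ≤ d * ∑ j ∈ copies Γ n, s j :=
      sum_sum_N_left_le hs0
    have e3 : ∑ j ∈ copies Γ n, ∑ k ∈ N Γ μ I j, s k ≤ d * ∑ j ∈ copies Γ n, s j :=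
      sum_sum_N_right_le hs0
    have e4 : ∑ j ∈ copies Γ n, ∑ _k ∈ N Γ μ I j, δ j ≤ d * ∑ j ∈ copies Γ n, δ j :=
      sum_sum_N_left_le hδ0
    have e5 := mul_le_mul_of_nonneg_left e1 hd0
    have f1 : ∑ j ∈ copies Γ n, (u * (d * u * (u * s j)) + u * δ j * (d * u) ^ 2)
        = u ^ 3 * (d * ∑ j ∈ copies Γ n, s j + d ^ 2 * ∑ j ∈ copies Γ n, δ j) := by
      simp only [Finset.mul_sum, mul_add, ← Finset.sum_add_distrib]
      exact Finset.sum_congr rfl fun j _ => by ring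
    have f2 : ∑ j ∈ copies Γ n, ∑ k ∈ N Γ μ I j,
          (2 * u ^ 2 * (u * (s j + s k)) + (u * (u * δ k) + u * δ j * u) * (2 * d * u))
        = u ^ 3 * (2 * (∑ j ∈ copies Γ n, ∑ _k ∈ N Γ μ I j, s j
            + ∑ j ∈ copies Γ n, ∑ k ∈ N Γ μ I j, s k)
          + 2 * d * (∑ j ∈ copies Γ n, ∑ _k ∈ N Γ μ I j, δ j
            + ∑ j ∈ copies Γ n, ∑ k ∈ N Γ μ I j, δ k)) := by
      simp only [← Finset.sum_add_distrib, Finset.mul_sum, mul_add]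
      exact Finset.sum_congr rfl fun j _ => Finset.sum_congr rfl fun k _ => by ring
    have f0 : ∑ j ∈ copies Γ n, ∑ k ∈ N Γ μ I j, δ k = ∑ j ∈ copies Γ n, s j := rfl
    rw [f1, f2, f0, ← mul_add]
    have f3 : 10 * d ^ 2 * u ^ 3 * ∑ j ∈ copies Γ n, δ j
        = u ^ 3 * (10 * d ^ 2 * ∑ j ∈ copies Γ n, δ j) := by ring
    rw [f3]
    refine mul_le_mul_of_nonneg_left ?_ (pow_nonneg hu0 3)
    have e6 := mul_le_mul_of_nonneg_left e4 hd0
    nlinarith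

/-- Expand `1 = Var W` into covariances, discard the pairs outside `N_j`, and bound one factor of
each remaining product by `σ⁻¹`. -/
theorem one_le_D_mul_sum (hI : IsBernoulliFamily I μ p) (hσ : 0 < sigma Γ μ I) :
    1 ≤ D Γ μ I * ((sigma Γ μ I)⁻¹ * ∑ j ∈ copies Γ n, ∫ ω, |X Γ μ I j ω| ∂μ) := by
  have hσ2 : sigma Γ μ I ^ 2 = ∑ j ∈ copies Γ n, ∑ k ∈ copies Γ n, cov[Y I j, Y I k; μ] := by
    rw [sigma, Real.sq_sqrt (variance_nonneg _ _), variance_fun_sum' fun j _ => hI.memLp_Y j]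
  have h1 : 1 = ∑ j ∈ copies Γ n, ∑ k ∈ copies Γ n, ∫ ω, X Γ μ I j ω * X Γ μ I k ω ∂μ := by
    simp only [covariance_X hI, ← hI.covariance_Y, ← Finset.mul_sum, ← hσ2]
    field_simp
  rw [h1, Finset.mul_sum]
  refine le_trans (Finset.sum_le_sum fun j hj => ?_) (sum_sum_N_left_le (Γ := Γ) (μ := μ) (I := I)
    (g := fun j => (sigma Γ μ I)⁻¹ * ∫ ω, |X Γ μ I j ω| ∂μ) fun j =>
      mul_nonneg (inv_nonneg.2 hσ.le) (integral_nonneg fun ω => abs_nonneg _))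
  rw [← Finset.sum_subset (fun k hk => mem_copies_of_mem_N hk)
    fun k hk hk' => hI.integral_X_mul_X_eq_zero hk hk']
  refine Finset.sum_le_sum fun k _ => ?_
  rw [← integral_const_mul]
  refine integral_mono ((hI.memLp_X j).integrable_mul (hI.memLp_X k))
    (((hI.memLp_X j).integrable (by norm_num)).abs.const_mul _) fun ω => ?_
  refine (le_abs_self _).trans ?_
  simp only [abs_mul]
  rw [mul_comm]
  exact mul_le_mul_of_nonneg_right (hI.abs_X_le hσ k ω) (abs_nonneg _)

/-- The covariance of `H_t` and `e^{-itW}` is controlled by the variance of any function whose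
increments dominate those of `H_t`. -/
theorem IsBernoulliFamily.norm_complexCov_H_le (hI : IsBernoulliFamily I μ p)
    (hσ : 0 < sigma Γ μ I) (t : ℝ) {P : Ω → ℝ}
    (hP : ∀ ω ω', (∀ e, I e ω ≤ I e ω') → ‖H Γ μ I t ω' - H Γ μ I t ω‖ ≤ P ω' - P ω) :
    ‖complexCov μ (H Γ μ I t)
        (fun ω => Complex.exp (-(Complex.I * (t : ℂ) * (W Γ μ I ω : ℂ))))‖
      ≤ Real.sqrt (variance P μ) := by
  obtain ⟨hp0, hp1⟩ := hI.p_pos hσ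
  obtain ⟨h1, h2, h3⟩ := hI.variance_le hp0 hp1 hP
  refine Real.le_sqrt_of_sq_le ((norm_complexCov_le h2 h1 ?_ fun ω => ?_).trans h3)
  · have hW : Measurable (W Γ μ I) := Finset.measurable_fun_sum _ fun j _ => hI.measurable_X j
    exact (Complex.measurable_exp.comp
      ((Complex.measurable_ofReal.comp hW).const_mul _).neg).aestronglyMeasurable
  · rw [show -(Complex.I * t * (W Γ μ I ω : ℂ)) = ((-(t * W Γ μ I ω) : ℝ) : ℂ) * Complex.I by
      push_cast; ring, Complex.norm_exp_ofReal_mul_I]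

theorem norm_complexCov_H_le_D (hI : IsBernoulliFamily I μ p) (hσ : 0 < sigma Γ μ I) (t : ℝ) :
    ‖complexCov μ (H Γ μ I t)
        (fun ω => Complex.exp (-(Complex.I * (t : ℂ) * (W Γ μ I ω : ℂ))))‖
      ≤ 20 * (D Γ μ I : ℝ) ^ (5 / 2 : ℝ) / sigma Γ μ I ^ (5 / 2 : ℝ)
        * Real.sqrt (∑ j ∈ copies Γ n, ∫ ω, |X Γ μ I j ω| ∂μ) := by
  refine (hI.norm_complexCov_H_le hσ t (P := fun ω => 10 * (D Γ μ I : ℝ) ^ 2 * (sigma Γ μ I)⁻¹ ^ 3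
    * ∑ j ∈ copies Γ n, Y I j ω) fun ω ω' h => ?_).trans ?_
  · rw [← mul_sub, ← Finset.sum_sub_distrib]
    exact hI.norm_H_sub_le_mul hσ t h
  have hvar : variance (fun ω => ∑ j ∈ copies Γ n, Y I j ω) μ = sigma Γ μ I ^ 2 := by
    rw [sigma, Real.sq_sqrt (variance_nonneg _ _)]
  rw [variance_const_mul, hvar]
  have h1 := one_le_D_mul_sum hI hσ
  set σ := sigma Γ μ I
  set d : ℝ := (D Γ μ I : ℝ)
  set S := ∑ j ∈ copies Γ n, ∫ ω, |X Γ μ I j ω| ∂μ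
  have hd0 : 0 ≤ d := Nat.cast_nonneg _
  have hS : 0 ≤ S := Finset.sum_nonneg fun j _ => integral_nonneg fun ω => abs_nonneg _
  have e : ∀ x : ℝ, 0 ≤ x → x ^ (5 / 2 : ℝ) = Real.sqrt (x ^ 5) := fun x hx => by
    rw [Real.sqrt_eq_rpow, ← Real.rpow_natCast, ← Real.rpow_mul hx]
    norm_num
  rw [e d hd0, e σ hσ.le, mul_div_assoc, ← Real.sqrt_div (by positivity), mul_assoc (20 : ℝ),
    ← Real.sqrt_mul (by positivity), show (20 : ℝ) = Real.sqrt (20 ^ 2) by simp,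
    ← Real.sqrt_mul (by positivity)]
  -- After squaring, `100 D⁴ σ⁻⁴` is compared with `400 D⁴ σ⁻⁴ · (D σ⁻¹ S)`, and the last factor is
  -- at least one; a factor of four is to spare.
  refine Real.sqrt_le_sqrt ?_
  have h2 : (10 * d ^ 2 * σ⁻¹ ^ 3) ^ 2 * σ ^ 2 = 100 * (d ^ 4 / σ ^ 4) := by
    field_simp
    ring
  have h3 : 20 ^ 2 * (d ^ 5 / σ ^ 5 * S) = 400 * (d ^ 4 / σ ^ 4) * (d * (σ⁻¹ * S)) := by
    field_simp
    ring
  rw [h2, h3]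
  have h4 : 0 ≤ d ^ 4 / σ ^ 4 := by positivity
  nlinarith

end Increments

/-! ### Moments of the triple majorants -/

section Majorants

variable {Ω : Type*} [MeasurableSpace Ω] {n : ℕ} {I : Edge n → Ω → ℝ} {μ : Measure Ω} {p : ℝ}

/-- The nonnegative majorant `Y_j + E[Y_j]` of `|Y_j - E[Y_j]|`. -/
def U (I : Edge n → Ω → ℝ) (p : ℝ) (j : Finset (Edge n)) (ω : Ω) : ℝ :=
  Y I j ω + p ^ j.card

/-- `G` is a function of the edge indicators with `E[Y_B G] ≤ κ E[Y_A Y_B]` for all `B`. -/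
structure MomentBound (I : Edge n → Ω → ℝ) (μ : Measure Ω) (p κ : ℝ) (A : Finset (Edge n))
    (G : Ω → ℝ) : Prop where
  factors : ∀ ω ω', (∀ e, I e ω = I e ω') → G ω = G ω'
  le : ∀ B, ∫ ω, Y I B ω * G ω ∂μ ≤ κ * p ^ (A ∪ B).card

theorem MomentBound.one (hI : IsBernoulliFamily I μ p) : MomentBound I μ p 1 ∅ fun _ => 1 where
  factors _ _ _ := rfl
  le B := by simp [hI.integral_Y]

theorem MomentBound.mul_Y (hI : IsBernoulliFamily I μ p) {κ : ℝ} {A : Finset (Edge n)}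
    {G : Ω → ℝ} (hG : MomentBound I μ p κ A G) (j : Finset (Edge n)) :
    MomentBound I μ p κ (A ∪ j) fun ω => G ω * Y I j ω where
  factors ω ω' h := by simp only [Y, h, hG.factors ω ω' h]
  le B := by
    have e : ∀ ω, Y I B ω * (G ω * Y I j ω) = Y I (j ∪ B) ω * G ω := fun ω => by
      rw [← hI.Y_mul_Y]
      ring
    simp only [e]
    rw [Finset.union_assoc]
    exact hG.le (j ∪ B)

/-- Replacing `Y_j` by its mean only helps: `p ^ |A ∪ B| p ^ |j| ≤ p ^ |A ∪ B ∪ j|`, since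
cardinality is subadditive and `p ≤ 1`. -/
theorem MomentBound.mul_pow {κ : ℝ} {A : Finset (Edge n)} {G : Ω → ℝ}
    (hG : MomentBound I μ p κ A G) (hκ : 0 ≤ κ) (hp0 : 0 ≤ p) (hp1 : p ≤ 1)
    (j : Finset (Edge n)) : MomentBound I μ p κ (A ∪ j) fun ω => G ω * p ^ j.card where
  factors ω ω' h := by simp only [hG.factors ω ω' h]
  le B := by
    simp only [← mul_assoc]
    rw [integral_mul_const]
    refine (mul_le_mul_of_nonneg_right (hG.le B) (pow_nonneg hp0 _)).trans ?_
    rw [mul_assoc, ← pow_add]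
    refine mul_le_mul_of_nonneg_left (pow_le_pow_of_le_one hp0 hp1 ?_) hκ
    rw [Finset.union_right_comm]
    exact Finset.card_union_le _ _

theorem IsBernoulliFamily.integral_prod_Y (hI : IsBernoulliFamily I μ p)
    (a b c a' b' c' : Finset (Edge n)) :
    ∫ ω, ∏ m : Fin 6, Y I (![a, b, c, a', b', c'] m) ω ∂μ
      = p ^ (a ∪ b ∪ c ∪ a' ∪ b' ∪ c').card := by
  rw [← hI.integral_Y]
  refine integral_congr_ae (Filter.Eventually.of_forall fun ω => ?_)
  simp only [← hI.Y_mul_Y, Fin.prod_univ_six]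
  rfl

theorem U_nonneg (hI : IsBernoulliFamily I μ p) (hp0 : 0 ≤ p) (j : Finset (Edge n)) (ω : Ω) :
    0 ≤ U I p j ω :=
  add_nonneg (hI.Y_nonneg j ω) (pow_nonneg hp0 _)

/-- The contribution of a triple to the function whose increments dominate those of `H_t`. -/
def tripleTerm (I : Edge n → Ω → ℝ) (p : ℝ) (j k l : Finset (Edge n)) (ω : Ω) : ℝ :=
  (2 * (U I p j ω * U I p k ω) + p ^ (j ∪ k).card) * U I p l ω

theorem tripleTerm_nonneg (hI : IsBernoulliFamily I μ p) (hp0 : 0 ≤ p) (j k l : Finset (Edge n))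
    (ω : Ω) : 0 ≤ tripleTerm I p j k l ω := by
  have h1 := U_nonneg hI hp0 j ω
  have h2 := U_nonneg hI hp0 k ω
  have h3 := U_nonneg hI hp0 l ω
  unfold tripleTerm
  positivity

variable [IsProbabilityMeasure μ]

theorem MomentBound.add (hI : IsBernoulliFamily I μ p) {κ κ' : ℝ} {A : Finset (Edge n)}
    {G G' : Ω → ℝ} (hG : MomentBound I μ p κ A G) (hG' : MomentBound I μ p κ' A G') :
    MomentBound I μ p (κ + κ') A fun ω => G ω + G' ω where
  factors ω ω' h := by rw [hG.factors ω ω' h, hG'.factors ω ω' h]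
  le B := by
    simp only [mul_add, add_mul]
    rw [integral_add (hI.integrable fun ω ω' h => by simp only [Y, h, hG.factors ω ω' h])
      (hI.integrable fun ω ω' h => by simp only [Y, h, hG'.factors ω ω' h])]
    exact add_le_add (hG.le B) (hG'.le B)

theorem MomentBound.mul_U (hI : IsBernoulliFamily I μ p) {κ : ℝ} {A : Finset (Edge n)}
    {G : Ω → ℝ} (hG : MomentBound I μ p κ A G) (hκ : 0 ≤ κ) (hp0 : 0 ≤ p) (hp1 : p ≤ 1)
    (j : Finset (Edge n)) : MomentBound I μ p (2 * κ) (A ∪ j) fun ω => G ω * U I p j ω := by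
  simp only [U, mul_add, two_mul]
  exact (hG.mul_Y hI j).add hI (hG.mul_pow hκ hp0 hp1 j)

/-- Each factor `U` doubles the constant: `2 · 2 · 2` from the product `2 U_j U_k`, plus `1` from `p
^ |j ∪ k|`, then doubled by `U_l`, which gives `18`. -/
theorem MomentBound.mul_tripleTerm (hI : IsBernoulliFamily I μ p) {κ : ℝ}
    {A : Finset (Edge n)} {G : Ω → ℝ} (hG : MomentBound I μ p κ A G) (hκ : 0 ≤ κ) (hp0 : 0 ≤ p)
    (hp1 : p ≤ 1) (j k l : Finset (Edge n)) :
    MomentBound I μ p (18 * κ) (A ∪ j ∪ k ∪ l) fun ω => G ω * tripleTerm I p j k l ω := by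
  have h1 : MomentBound I μ p (4 * κ) (A ∪ j ∪ k) fun ω => G ω * U I p j ω * U I p k ω := by
    convert (hG.mul_U hI hκ hp0 hp1 j).mul_U hI (by positivity) hp0 hp1 k using 1
    ring
  have h2 : MomentBound I μ p κ (A ∪ j ∪ k) fun ω => G ω * p ^ (j ∪ k).card := by
    rw [Finset.union_assoc]
    exact hG.mul_pow hκ hp0 hp1 (j ∪ k)
  convert ((h1.add hI h1).add hI h2).mul_U hI (by positivity) hp0 hp1 l using 1
  · ring
  · ext ω
    rw [tripleTerm]
    ring

theorem memLp_tripleTerm (hI : IsBernoulliFamily I μ p) (j k l : Finset (Edge n)) :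
    MemLp (tripleTerm I p j k l) 2 μ :=
  hI.memLp fun ω ω' h => by simp only [tripleTerm, U, Y, h]

theorem covariance_tripleTerm_le (hI : IsBernoulliFamily I μ p) (hp0 : 0 ≤ p) (hp1 : p ≤ 1)
    (j k l j' k' l' : Finset (Edge n)) :
    cov[tripleTerm I p j k l, tripleTerm I p j' k' l'; μ]
      ≤ 324 * p ^ (j ∪ k ∪ l ∪ j' ∪ k' ∪ l').card := by
  rw [covariance_eq_sub (memLp_tripleTerm hI _ _ _) (memLp_tripleTerm hI _ _ _)]
  have h0 := integral_nonneg (μ := μ) (f := tripleTerm I p j k l)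
    fun ω => tripleTerm_nonneg hI hp0 j k l ω
  have h0' := integral_nonneg (μ := μ) (f := tripleTerm I p j' k' l')
    fun ω => tripleTerm_nonneg hI hp0 j' k' l' ω
  have h1 := (((MomentBound.one hI).mul_tripleTerm hI zero_le_one hp0 hp1 j k l).mul_tripleTerm hI
    (by norm_num) hp0 hp1 j' k' l').le ∅
  simp only [Y, Finset.prod_empty, one_mul, Finset.empty_union, Finset.union_empty] at h1
  -- The product of the means is nonnegative and is dropped from the covariance.
  have h2 := mul_nonneg h0 h0'
  rw [show (18 * (18 * 1) : ℝ) = 324 by norm_num] at h1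
  simp only [Pi.mul_apply]
  linarith

theorem covariance_tripleTerm_eq_zero (hI : IsBernoulliFamily I μ p)
    {j k l j' k' l' : Finset (Edge n)} (h : Disjoint (j ∪ k ∪ l) (j' ∪ k' ∪ l')) :
    cov[tripleTerm I p j k l, tripleTerm I p j' k' l'; μ] = 0 := by
  have hm : ∀ j k l : Finset (Edge n), Measurable[⨆ e ∈ ((j ∪ k ∪ l : Finset (Edge n)) :
      Set (Edge n)), MeasurableSpace.comap (I e) inferInstance] (tripleTerm I p j k l) := by
    intro j k l
    have hj := measurable_Y_iSup I (A := j) (B := j ∪ k ∪ l) (by grind)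
    have hk := measurable_Y_iSup I (A := k) (B := j ∪ k ∪ l) (by grind)
    have hl := measurable_Y_iSup I (A := l) (B := j ∪ k ∪ l) (by grind)
    exact (((((hj.add_const _).mul (hk.add_const _)).const_mul 2).add_const _).mul
      (hl.add_const _))
  exact (hI.indepFun_of_disjoint h (hm j k l) (hm j' k' l')).covariance_eq_zero
    (memLp_tripleTerm hI _ _ _) (memLp_tripleTerm hI _ _ _)

end Majorants

/-! ### Joining two triples to a chain -/

section Chains

variable {V Ω : Type*} [MeasurableSpace Ω] {Γ : SimpleGraph V} {n : ℕ} {I : Edge n → Ω → ℝ}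
  {μ : Measure Ω} {p : ℝ}

theorem mem_chains {a b c a' b' c' : Finset (Edge n)} (ha : a ∈ copies Γ n) (hb : b ∈ N Γ μ I a)
    (hc : c ∈ N Γ μ I a ∨ c ∈ N Γ μ I b)
    (ha' : a' ∈ N Γ μ I a ∨ a' ∈ N Γ μ I b ∨ a' ∈ N Γ μ I c)
    (hb' : b' ∈ N Γ μ I a') (hc' : c' ∈ N Γ μ I a' ∨ c' ∈ N Γ μ I b') :
    ![a, b, c, a', b', c'] ∈ chains Γ μ I := by
  classical
  have hc0 : c ∈ copies Γ n := hc.elim mem_copies_of_mem_N mem_copies_of_mem_N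
  have ha0 : a' ∈ copies Γ n :=
    ha'.elim mem_copies_of_mem_N fun h => h.elim mem_copies_of_mem_N mem_copies_of_mem_N
  have hc0' : c' ∈ copies Γ n := hc'.elim mem_copies_of_mem_N mem_copies_of_mem_N
  simp only [chains, Finset.mem_filter, Fintype.mem_piFinset]
  refine ⟨fun m => ?_, fun m hm => ?_⟩
  · fin_cases m
    exacts [ha, mem_copies_of_mem_N hb, hc0, ha0, mem_copies_of_mem_N hb', hc0']
  · fin_cases m
    · exact absurd hm (lt_irrefl _)
    · exact ⟨0, by decide, hb⟩
    · rcases hc with h | h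
      exacts [⟨0, by decide, h⟩, ⟨1, by decide, h⟩]
    · rcases ha' with h | h | h
      exacts [⟨0, by decide, h⟩, ⟨1, by decide, h⟩, ⟨2, by decide, h⟩]
    · exact ⟨3, by decide, hb'⟩
    · rcases hc' with h | h
      exacts [⟨3, by decide, h⟩, ⟨4, by decide, h⟩]

/-- Triples of sets of edges. -/
abbrev Triple (n : ℕ) : Type := Σ _ : (Σ _ : Finset (Edge n), Finset (Edge n)), Finset (Edge n)

open Classical in
/-- The triples `(j, k, l)` of copies with `k ∈ N_j` and `l ∈ N_j ∪ N_k`. -/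
noncomputable def triples (Γ : SimpleGraph V) (μ : Measure Ω) (I : Edge n → Ω → ℝ) : Finset (Triple n) :=
  ((copies Γ n).sigma fun j => N Γ μ I j).sigma fun x => N Γ μ I x.1 ∪ N Γ μ I x.2

theorem mem_triples {T : Triple n} :
    T ∈ triples Γ μ I ↔ T.1.1 ∈ copies Γ n ∧ T.1.2 ∈ N Γ μ I T.1.1
      ∧ (T.2 ∈ N Γ μ I T.1.1 ∨ T.2 ∈ N Γ μ I T.1.2) := by
  simp [triples, and_assoc]

/-- The four orders in which two triples are joined to a chain. -/
def join (i : Fin 4) (x : Triple n × Triple n) : Fin 6 → Finset (Edge n) :=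
  ![![x.1.1.1, x.1.1.2, x.1.2, x.2.1.1, x.2.1.2, x.2.2],
    ![x.1.1.1, x.1.1.2, x.1.2, x.2.1.2, x.2.1.1, x.2.2],
    ![x.1.1.1, x.1.1.2, x.1.2, x.2.2, x.2.1.1, x.2.1.2],
    ![x.1.1.1, x.1.1.2, x.1.2, x.2.2, x.2.1.2, x.2.1.1]] i

theorem join_injective (i : Fin 4) : Function.Injective (join (n := n) i) := by
  rintro ⟨⟨⟨a, b⟩, c⟩, ⟨⟨a', b'⟩, c'⟩⟩ ⟨⟨⟨d, e⟩, f⟩, ⟨⟨d', e'⟩, f'⟩⟩ h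
  have h0 := congrFun h 0
  have h1 := congrFun h 1
  have h2 := congrFun h 2
  have h3 := congrFun h 3
  have h4 := congrFun h 4
  have h5 := congrFun h 5
  fin_cases i <;> simp [join] at h0 h1 h2 h3 h4 h5 <;> simp [*]

/-- The second triple is connected under the symmetric relation of dependence, so it can be
traversed from whichever member `b` is linked to the first triple. Starting at the third member
takes two orders, according to which of the other two it is linked to. -/
theorem exists_join_mem_chains {x : Triple n × Triple n} (h1 : x.1 ∈ triples Γ μ I)
    (h2 : x.2 ∈ triples Γ μ I)
    (h : ∃ b, (b = x.2.1.1 ∨ b = x.2.1.2 ∨ b = x.2.2) ∧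
      (b ∈ N Γ μ I x.1.1.1 ∨ b ∈ N Γ μ I x.1.1.2 ∨ b ∈ N Γ μ I x.1.2)) :
    ∃ i, join i x ∈ chains Γ μ I := by
  obtain ⟨hj, hk, hl⟩ := mem_triples.1 h1
  obtain ⟨hj', hk', hl'⟩ := mem_triples.1 h2
  obtain ⟨b, rfl | rfl | rfl, hb⟩ := h
  · exact ⟨0, mem_chains hj hk hl hb hk' hl'⟩
  · exact ⟨1, mem_chains hj hk hl hb (mem_N_symm hj' hk') hl'.symm⟩
  · rcases hl' with h | h
    · exact ⟨2, mem_chains hj hk hl hb (mem_N_symm hj' h) (Or.inr hk')⟩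
    · exact ⟨3, mem_chains hj hk hl hb (mem_N_symm (mem_copies_of_mem_N hk') h)
        (Or.inr (mem_N_symm hj' hk'))⟩

theorem integral_join (hI : IsBernoulliFamily I μ p) (i : Fin 4) (x : Triple n × Triple n) :
    ∫ ω, ∏ m : Fin 6, Y I (join i x m) ω ∂μ
      = p ^ (x.1.1.1 ∪ x.1.1.2 ∪ x.1.2 ∪ x.2.1.1 ∪ x.2.1.2 ∪ x.2.2).card := by
  fin_cases i
  · exact hI.integral_prod_Y _ _ _ _ _ _
  all_goals
    exact (hI.integral_prod_Y _ _ _ _ _ _).trans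
      (congrArg (fun s : Finset (Edge n) => p ^ s.card) (by ac_rfl))

variable [IsProbabilityMeasure μ]

-- If no order gives a chain, the triples have disjoint edge sets and their covariance is zero.
-- Otherwise it is at most `324` times the weight of a chain; four orders give `1296`.
open Classical in
theorem sum_covariance_tripleTerm_le (hI : IsBernoulliFamily I μ p) (hσ : 0 < sigma Γ μ I) :
    ∑ T ∈ triples Γ μ I, ∑ T' ∈ triples Γ μ I,
        cov[tripleTerm I p T.1.1 T.1.2 T.2, tripleTerm I p T'.1.1 T'.1.2 T'.2; μ]
      ≤ 1296 * ∑ j ∈ chains Γ μ I, ∫ ω, ∏ m : Fin 6, Y I (j m) ω ∂μ := by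
  obtain ⟨hp0, hp1⟩ := hI.p_pos hσ
  set w : (Fin 6 → Finset (Edge n)) → ℝ := fun j => ∫ ω, ∏ m : Fin 6, Y I (j m) ω ∂μ with hw
  have hw0 : ∀ j, 0 ≤ w j := fun j =>
    integral_nonneg fun ω => Finset.prod_nonneg fun m _ => hI.Y_nonneg _ ω
  have key : ∀ x ∈ triples Γ μ I ×ˢ triples Γ μ I,
      cov[tripleTerm I p x.1.1.1 x.1.1.2 x.1.2, tripleTerm I p x.2.1.1 x.2.1.2 x.2.2; μ]
        ≤ ∑ i : Fin 4, 324 * (if join i x ∈ chains Γ μ I then w (join i x) else 0) := by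
    intro x hx
    obtain ⟨h1, h2⟩ := Finset.mem_product.1 hx
    have hnn : ∀ i : Fin 4,
        0 ≤ 324 * (if join i x ∈ chains Γ μ I then w (join i x) else 0) := fun i => by
      have := hw0 (join i x)
      split_ifs <;> positivity
    by_cases h : ∃ i, join i x ∈ chains Γ μ I
    · obtain ⟨i, hi⟩ := h
      refine le_trans ?_ (Finset.single_le_sum (fun i _ => hnn i) (Finset.mem_univ i))
      rw [if_pos hi, hw]
      dsimp only
      rw [integral_join hI]
      exact covariance_tripleTerm_le hI hp0.le hp1.le _ _ _ _ _ _
    · refine le_trans (le_of_eq ?_) (Finset.sum_nonneg fun i _ => hnn i)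
      refine covariance_tripleTerm_eq_zero hI ?_
      have h' : ∀ b, (b = x.2.1.1 ∨ b = x.2.1.2 ∨ b = x.2.2) →
          ¬ (b ∈ N Γ μ I x.1.1.1 ∨ b ∈ N Γ μ I x.1.1.2 ∨ b ∈ N Γ μ I x.1.2) :=
        fun b hb hb' => h (exists_join_mem_chains h1 h2 ⟨b, hb, hb'⟩)
      obtain ⟨hj', hk', hl'⟩ := mem_triples.1 h2
      have hd : ∀ b, (b = x.2.1.1 ∨ b = x.2.1.2 ∨ b = x.2.2) →
          Disjoint (x.1.1.1 ∪ x.1.1.2 ∪ x.1.2) b := by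
        intro b hb
        have hbJ : b ∈ copies Γ n := by
          rcases hb with rfl | rfl | rfl
          exacts [hj', mem_copies_of_mem_N hk', hl'.elim mem_copies_of_mem_N mem_copies_of_mem_N]
        have hn := h' b hb
        push Not at hn
        have hdis : ∀ a, b ∉ N Γ μ I a → Disjoint a b := fun a ha => by
          by_contra hab
          exact ha (hI.mem_N hσ hbJ hab)
        exact Finset.disjoint_union_left.2
          ⟨Finset.disjoint_union_left.2 ⟨hdis _ hn.1, hdis _ hn.2.1⟩, hdis _ hn.2.2⟩
      exact Finset.disjoint_union_right.2 ⟨Finset.disjoint_union_right.2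
        ⟨hd _ (Or.inl rfl), hd _ (Or.inr (Or.inl rfl))⟩, hd _ (Or.inr (Or.inr rfl))⟩
  rw [← Finset.sum_product']
  refine (Finset.sum_le_sum key).trans ?_
  rw [Finset.sum_comm]
  -- For a fixed order the pair of triples is recovered from the chain, so each chain is counted at
  -- most once.
  have hi : ∀ i : Fin 4, ∑ x ∈ triples Γ μ I ×ˢ triples Γ μ I,
      324 * (if join i x ∈ chains Γ μ I then w (join i x) else 0)
        ≤ 324 * ∑ j ∈ chains Γ μ I, w j := by
    intro i
    rw [← Finset.mul_sum, ← Finset.sum_filter,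
      ← Finset.sum_image (f := w) (g := join i) ((join_injective i).injOn)]
    refine mul_le_mul_of_nonneg_left (Finset.sum_le_sum_of_subset_of_nonneg ?_ fun j _ _ => hw0 j)
      (by norm_num)
    intro j hj
    obtain ⟨x, hx, rfl⟩ := Finset.mem_image.1 hj
    exact (Finset.mem_filter.1 hx).2
  refine (Finset.sum_le_sum fun i _ => hi i).trans_eq ?_
  rw [Finset.sum_const, Finset.card_univ, Fintype.card_fin, nsmul_eq_mul]
  ring

end Chains

/-! ### Domination of `H_t` by triples and the bound with chains -/

section Domination

variable {V Ω : Type*} [MeasurableSpace Ω] {Γ : SimpleGraph V} {n : ℕ} {I : Edge n → Ω → ℝ}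
  {μ : Measure Ω} {p : ℝ}

open Classical in
theorem Zj_add_Vjk (j k : Finset (Edge n)) (ω : Ω) :
    Zj Γ μ I j ω + Vjk Γ μ I j k ω = ∑ l ∈ N Γ μ I j ∪ N Γ μ I k, X Γ μ I l ω := by
  rw [← Finset.union_sdiff_self_eq_union, Finset.sum_union Finset.disjoint_sdiff]
  rfl

theorem U_mono (hI : IsBernoulliFamily I μ p) (j : Finset (Edge n)) {ω ω' : Ω}
    (h : ∀ e, I e ω ≤ I e ω') : U I p j ω ≤ U I p j ω' :=
  add_le_add_left (hI.Y_mono j h) _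

theorem abs_X_le_U (hI : IsBernoulliFamily I μ p) (hσ : 0 < sigma Γ μ I) (hp0 : 0 ≤ p)
    (j : Finset (Edge n)) (ω : Ω) : |X Γ μ I j ω| ≤ (sigma Γ μ I)⁻¹ * U I p j ω := by
  rw [X, abs_mul, abs_of_pos (inv_pos.2 hσ), hI.integral_Y, U]
  refine mul_le_mul_of_nonneg_left ((abs_sub _ _).trans_eq ?_) (inv_nonneg.2 hσ.le)
  rw [abs_of_nonneg (hI.Y_nonneg j ω), abs_of_nonneg (pow_nonneg hp0 _)]

variable [IsProbabilityMeasure μ]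

-- The products of majorants of `X_j`, `X_k`, `Z_j` and `Z_j + V_{jk}` have increments dominating
-- those of `H_t`. Both parts of `H_t` contribute one `U_j U_k U_l`, hence the `2` in `tripleTerm`;
-- the centring term `E[X_j X_k]` contributes `p ^ |j ∪ k|`.
open Classical in
theorem norm_H_sub_le_triples (hI : IsBernoulliFamily I μ p) (hσ : 0 < sigma Γ μ I) (hp0 : 0 ≤ p)
    (hp1 : p ≤ 1) (t : ℝ) {ω ω' : Ω} (h : ∀ e, I e ω ≤ I e ω') :
    ‖H Γ μ I t ω' - H Γ μ I t ω‖
      ≤ (sigma Γ μ I)⁻¹ ^ 3 * (∑ T ∈ triples Γ μ I, tripleTerm I p T.1.1 T.1.2 T.2 ω'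
        - ∑ T ∈ triples Γ μ I, tripleTerm I p T.1.1 T.1.2 T.2 ω) := by
  set u := (sigma Γ μ I)⁻¹ with hu
  have hu0 : 0 ≤ u := inv_nonneg.2 hσ.le
  have hU0 : ∀ j ω, 0 ≤ U I p j ω := U_nonneg hI hp0
  have hU1 : ∀ j, U I p j ω ≤ U I p j ω' := fun j => U_mono hI j h
  have hX : ∀ j ω, |X Γ μ I j ω| ≤ u * U I p j ω := abs_X_le_U hI hσ hp0
  have hΔX : ∀ j, |X Γ μ I j ω' - X Γ μ I j ω| ≤ u * (U I p j ω' - U I p j ω) := fun j => by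
    rw [hI.abs_X_sub hσ h j, U, U, add_sub_add_right_eq_sub]
  have hS : ∀ (s : Finset (Finset (Edge n))) ω,
      |∑ l ∈ s, X Γ μ I l ω| ≤ u * ∑ l ∈ s, U I p l ω := fun s ω => by
    rw [Finset.mul_sum]
    exact (Finset.abs_sum_le_sum_abs _ _).trans (Finset.sum_le_sum fun l _ => hX l ω)
  have hΔS : ∀ s : Finset (Finset (Edge n)),
      |∑ l ∈ s, X Γ μ I l ω' - ∑ l ∈ s, X Γ μ I l ω|
        ≤ u * (∑ l ∈ s, U I p l ω' - ∑ l ∈ s, U I p l ω) := fun s => by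
    rw [← Finset.sum_sub_distrib, ← Finset.sum_sub_distrib, Finset.mul_sum]
    exact (Finset.abs_sum_le_sum_abs _ _).trans (Finset.sum_le_sum fun l _ => hΔX l)
  have hS0 : ∀ (s : Finset (Finset (Edge n))) ω, 0 ≤ ∑ l ∈ s, U I p l ω := fun s ω =>
    Finset.sum_nonneg fun l _ => hU0 l ω
  have hS1 : ∀ s : Finset (Finset (Edge n)), ∑ l ∈ s, U I p l ω ≤ ∑ l ∈ s, U I p l ω' :=
    fun s => Finset.sum_le_sum fun l _ => hU1 l
  have hE : ∀ j k, |∫ x, X Γ μ I j x * X Γ μ I k x ∂μ| ≤ u ^ 2 * p ^ (j ∪ k).card := fun j k => by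
    rw [covariance_X hI, abs_mul, abs_of_nonneg (pow_nonneg hu0 2)]
    refine mul_le_mul_of_nonneg_left (abs_le.2 ⟨?_, ?_⟩) (pow_nonneg hu0 2)
    · have h1 : p ^ j.card * p ^ k.card ≤ p ^ (j ∪ k).card := by
        rw [← pow_add]
        exact pow_le_pow_of_le_one hp0 hp1 (Finset.card_union_le j k)
      have h2 := pow_nonneg hp0 (j ∪ k).card
      linarith
    · have h1 := mul_nonneg (pow_nonneg hp0 j.card) (pow_nonneg hp0 k.card)
      linarith
  set L : Finset (Edge n) → Finset (Edge n) → Ω → ℝ :=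
    fun j k ω => ∑ l ∈ N Γ μ I j ∪ N Γ μ I k, U I p l ω with hL
  refine (norm_H_sub_le t ω ω'
    (a := fun j => ∑ k ∈ N Γ μ I j, u ^ 3 * (U I p j ω' * U I p k ω' * L j k ω'
      - U I p j ω * U I p k ω * L j k ω))
    (b := fun j k => u ^ 3 * ((U I p j ω' * U I p k ω' + p ^ (j ∪ k).card) * L j k ω'
      - (U I p j ω * U I p k ω + p ^ (j ∪ k).card) * L j k ω)) ?_ ?_).trans_eq ?_
  · intro j hj
    have hZ : ∀ ω, |Zj Γ μ I j ω| ≤ u * ∑ l ∈ N Γ μ I j, U I p l ω := hS _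
    have hm := hS1 (N Γ μ I j)
    have hm0 := hS0 (N Γ μ I j) ω
    have hZ' : |Zj Γ μ I j ω| ≤ u * ∑ l ∈ N Γ μ I j, U I p l ω' :=
      (hZ ω).trans (mul_le_mul_of_nonneg_left hm hu0)
    refine (norm_mul_sub_mul_le _ _ _ _ (by simpa using hX j ω')
      (norm_sq_mul_R_two_le t (hZ ω)) (α := u * (U I p j ω' - U I p j ω)) ?_
      ((norm_sq_mul_R_two_sub_le t hZ' (hZ ω')).trans
        (mul_le_mul_of_nonneg_left (hΔS (N Γ μ I j))
          (mul_nonneg hu0 (hm0.trans hm))))).trans ?_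
    · rw [← Complex.ofReal_sub, Complex.norm_real]
      exact hΔX j
    have h1 : ∀ k ∈ N Γ μ I j, u ^ 3 * (U I p j ω' * U I p k ω' * ∑ l ∈ N Γ μ I j, U I p l ω'
          - U I p j ω * U I p k ω * ∑ l ∈ N Γ μ I j, U I p l ω)
        ≤ u ^ 3 * (U I p j ω' * U I p k ω' * L j k ω' - U I p j ω * U I p k ω * L j k ω) := by
      intro k _
      refine mul_le_mul_of_nonneg_left ?_ (pow_nonneg hu0 3)
      -- Enlarging the range of `l` from `N_j` to `N_j ∪ N_k` adds only products of nonnegative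
      -- increasing functions, so the increment does not decrease.
      have hsplit : ∀ ω, L j k ω
          = ∑ l ∈ N Γ μ I j, U I p l ω + ∑ l ∈ N Γ μ I k \ N Γ μ I j, U I p l ω := fun ω => by
        simp only [hL]
        rw [← Finset.union_sdiff_self_eq_union, Finset.sum_union Finset.disjoint_sdiff]
      rw [hsplit, hsplit, mul_add, mul_add]
      have h2 := mul_le_mul (mul_le_mul (hU1 j) (hU1 k) (hU0 k ω) (hU0 j ω'))
        (hS1 (N Γ μ I k \ N Γ μ I j)) (hS0 _ ω) (mul_nonneg (hU0 j ω') (hU0 k ω'))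
      linarith
    refine le_trans ?_ (Finset.sum_le_sum h1)
    rw [← Finset.mul_sum, Finset.sum_sub_distrib, ← Finset.sum_mul, ← Finset.sum_mul,
      ← Finset.mul_sum, ← Finset.mul_sum]
    set m := ∑ l ∈ N Γ μ I j, U I p l ω
    set m' := ∑ l ∈ N Γ μ I j, U I p l ω'
    -- The Lipschitz constant uses `m'` instead of `m + m'`; this slack is exactly what separates
    -- the bound from the increment of `U_j m²`.
    have h3 : 0 ≤ u ^ 3 * (U I p j ω' * (m * (m' - m))) :=
      mul_nonneg (pow_nonneg hu0 3)
        (mul_nonneg (hU0 j ω') (mul_nonneg hm0 (sub_nonneg.2 hm)))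
    linarith
  · intro j hj k hk
    rw [Zj_add_Vjk, Zj_add_Vjk]
    refine (norm_mul_sub_mul_le _ _ _ _
      (A := u ^ 2 * (U I p j ω' * U I p k ω' + p ^ (j ∪ k).card))
      (α := u * U I p j ω' * (u * (U I p k ω' - U I p k ω))
        + u * (U I p j ω' - U I p j ω) * (u * U I p k ω)) ?_
      ((norm_mul_R_one_le t _).trans (hS _ ω)) ?_
      ((norm_mul_R_one_sub_le t _ _).trans (hΔS _))).trans_eq ?_
    · rw [Complex.norm_real]
      refine (abs_sub _ _).trans ?_
      rw [mul_add]
      refine add_le_add ?_ (hE j k)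
      rw [abs_mul]
      refine (mul_le_mul (hX j ω') (hX k ω') (abs_nonneg _)
        (mul_nonneg hu0 (hU0 j ω'))).trans_eq ?_
      ring
    · rw [← Complex.ofReal_sub, sub_sub_sub_cancel_right]
      push_cast
      refine norm_mul_sub_mul_le _ _ _ _ (by simpa using hX j ω') (by simpa using hX k ω) ?_ ?_
      · rw [← Complex.ofReal_sub, Complex.norm_real]
        exact hΔX j
      · rw [← Complex.ofReal_sub, Complex.norm_real]
        exact hΔX k
    · simp only [hL]
      ring
  · have hsum : ∀ ω, ∑ T ∈ triples Γ μ I, tripleTerm I p T.1.1 T.1.2 T.2 ω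
        = ∑ j ∈ copies Γ n, ∑ k ∈ N Γ μ I j,
          (2 * (U I p j ω * U I p k ω) + p ^ (j ∪ k).card) * L j k ω := fun ω => by
      simp only [triples, Finset.sum_sigma, tripleTerm, hL, Finset.mul_sum]
    rw [hsum, hsum]
    simp only [← Finset.sum_add_distrib, ← Finset.sum_sub_distrib, Finset.mul_sum]
    exact Finset.sum_congr rfl fun j _ => Finset.sum_congr rfl fun k _ => by ring

theorem norm_complexCov_H_le_chains (hI : IsBernoulliFamily I μ p) (hσ : 0 < sigma Γ μ I) (t : ℝ) :
    ‖complexCov μ (H Γ μ I t)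
        (fun ω => Complex.exp (-(Complex.I * (t : ℂ) * (W Γ μ I ω : ℂ))))‖
      ≤ 113 / sigma Γ μ I ^ 3
        * Real.sqrt (∑ j ∈ chains Γ μ I, ∫ ω, ∏ m : Fin 6, Y I (j m) ω ∂μ) := by
  obtain ⟨hp0, hp1⟩ := hI.p_pos hσ
  refine (hI.norm_complexCov_H_le hσ t (P := fun ω => (sigma Γ μ I)⁻¹ ^ 3
    * ∑ T ∈ triples Γ μ I, tripleTerm I p T.1.1 T.1.2 T.2 ω) fun ω ω' h => ?_).trans ?_
  · rw [← mul_sub]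
    exact norm_H_sub_le_triples hI hσ hp0.le hp1.le t h
  have h1 := sum_covariance_tripleTerm_le hI hσ
  rw [variance_const_mul, variance_fun_sum' fun T _ => memLp_tripleTerm hI T.1.1 T.1.2 T.2]
  set S := ∑ j ∈ chains Γ μ I, ∫ ω, ∏ m : Fin 6, Y I (j m) ω ∂μ
  have hS : 0 ≤ S := Finset.sum_nonneg fun j _ =>
    integral_nonneg fun ω => Finset.prod_nonneg fun m _ => hI.Y_nonneg _ ω
  set σ := sigma Γ μ I
  rw [Real.sqrt_mul (by positivity), Real.sqrt_sq (by positivity), inv_pow, div_mul_eq_mul_div,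
    mul_comm, ← div_eq_mul_inv]
  refine div_le_div_of_nonneg_right ?_ (by positivity)
  rw [show (113 : ℝ) = Real.sqrt (113 ^ 2) by simp, ← Real.sqrt_mul (by positivity)]
  refine Real.sqrt_le_sqrt (h1.trans ?_)
  -- The comparison is `1296 = 36² ≤ 113²`.
  linarith

end Domination

end SubgraphCount

theorem mainTheorem6 {V : Type*} [Fintype V] (Γ : SimpleGraph V)
    (hΓ_edge : Γ ≠ ⊥) (hΓ_iso : ∀ v, ∃ w, Γ.Adj v w)
    {Ω : Type*} [MeasurableSpace Ω] (μ : Measure Ω) [IsProbabilityMeasure μ]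
    (n : ℕ) (p : ℝ) (I : SubgraphCount.Edge n → Ω → ℝ)
    (hI_meas : ∀ e, Measurable (I e))
    (hI_ind : ∀ e ω, I e ω = 0 ∨ I e ω = 1)
    (hI_law : ∀ e, μ.real {ω | I e ω = 1} = p)
    (hI_indep : iIndepFun I μ)
    (hσ : 0 < SubgraphCount.sigma Γ μ I) (t : ℝ) :
    ‖SubgraphCount.complexCov μ (SubgraphCount.H Γ μ I t)
        (fun ω => Complex.exp (-(Complex.I * (t : ℂ) * (SubgraphCount.W Γ μ I ω : ℂ))))‖
      ≤ 20 * (SubgraphCount.D Γ μ I : ℝ) ^ (5 / 2 : ℝ) / SubgraphCount.sigma Γ μ I ^ (5 / 2 : ℝ)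
        * Real.sqrt (∑ j ∈ SubgraphCount.copies Γ n, ∫ ω, |SubgraphCount.X Γ μ I j ω| ∂μ)
    ∧
    ‖SubgraphCount.complexCov μ (SubgraphCount.H Γ μ I t)
        (fun ω => Complex.exp (-(Complex.I * (t : ℂ) * (SubgraphCount.W Γ μ I ω : ℂ))))‖
      ≤ 113 / SubgraphCount.sigma Γ μ I ^ 3
        * Real.sqrt (∑ j ∈ SubgraphCount.chains Γ μ I,
            ∫ ω, ∏ m : Fin 6, SubgraphCount.Y I (j m) ω ∂μ) := by
  have hI : SubgraphCount.IsBernoulliFamily I μ p := ⟨hI_meas, hI_ind, hI_law, hI_indep⟩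
  exact ⟨SubgraphCount.norm_complexCov_H_le_D hI hσ t,
    SubgraphCount.norm_complexCov_H_le_chains hI hσ t⟩
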